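/- Let $a<b$ be reals, $d\ge 1$ an integer, $0<1/p<\alpha<1$, and let $\|\cdot\|$ be the Euclidean norm of $\mathbb{R}^d$. For $\beta>0$ and $f:(a,b)\to\mathbb{R}^d$ put $$I^\beta_-f(t)=\frac1{\Gamma(\beta)}\int_a^t(t-\xi)^{\beta-1}f(\xi)\,d\xi,\qquad I^\beta_+f(t)=\frac1{\Gamma(\beta)}\int_t^b(\xi-t)^{\beta-1}f(\xi)\,d\xi,$$ and $D^\alpha_-f=\frac{d}{dt}I^{1-\alpha}_-f$, $D^\alpha_+f=-\frac{d}{dt}I^{1-\alpha}_+f$ (the left and right Riemann–Liouville fractional integrals and derivatives), wherever these are defined. Let $L^p=L^p((a,b);\mathbb{R}^d)$ and $$E_{\alpha,p}=\{u\in L^p:\ D^\alpha_-u\in L^p\ \text{and}\ I^\alpha_-(D^\alpha_-u)=u\},$$ where $D^\alpha_-u$ is required to exist almost everywhere and the equality holds almost everywhere. Let $L:\mathbb{R}^d\times\mathbb{R}^d\times[a,b]\to\mathbb{R}$, $(x,y,t)\mapsto L(x,y,t)$, be of class $C^1$ and assume that, for all $(x,y,t)\in\mathbb{R}^d\times\mathbb{R}^d\times[a,b]$: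 (H1) $|L(x,y,t)-L(x,0,t)|\le r_1(x,t)\|y\|^{d_1}+s_1(x,t)$ for some $0\le d_1\le p$ and some continuous $r_1,s_1:\mathbb{R}^d\times[a,b]\to[0,\infty)$; (H2) $\left\|\frac{\partial L}{\partial x}(x,y,t)\right\|\le r_2(x,t)\|y\|^{d_2}+s_2(x,t)$ for some $0\le d_2\le p$ and some continuous $r_2,s_2:\mathbb{R}^d\times[a,b]\to[0,\infty)$; (H3) $\left\|\frac{\partial L}{\partial y}(x,y,t)\right\|\le r_3(x,t)\|y\|^{d_3}+s_3(x,t)$ for some $0\le d_3\le p-1$ and some continuous $r_3,s_3:\mathbb{R}^d\times[a,b]\to[0,\infty)$; (H4) $L(x,y,t)\ge c_1(x,t)\|y\|^p+c_2(t)\|x\|^{d_4}+c_3(t)$ for some $\gamma>0$, $1\le d_4<p$, and some continuous $c_1:\mathbb{R}^d\times[a,b]\to[\gamma,\infty)$ and $c_2,c_3:[a,b]\to\mathbb{R}$; (H5) for every $t\in[a,b]$ the function $L(\cdot,\cdot,t)$ is convex on $\mathbb{R}^d\times\mathbb{R}^d$. Then for every $v\in E_{\alpha,p}$ the function $t\mapsto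 L(v(t),D^\alpha_-v(t),t)$ is integrable on $(a,b)$, and the functional $\mathcal L(v)=\int_a^bL(v,D^\alpha_-v,t)\,dt$ attains a global minimum on $E_{\alpha,p}$ at some $u$ which is continuous on $[a,b]$ and satisfies the fractional Euler–Lagrange equation $$\frac{\partial L}{\partial x}(u,D^\alpha_-u,t)+D^\alpha_+\Big(\frac{\partial L}{\partial y}(u,D^\alpha_-u,t)\Big)=0$$ for almost every $t\in[a,b]$, all the derivatives in it being defined for almost every $t$. -/

import Mathlib

open Set Filter Topology MeasureTheory

noncomputable section

/-- `ℝ^d` with its Euclidean norm. -/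
abbrev Rd (d : ℕ) : Type := EuclideanSpace ℝ (Fin d)

/-- Lebesgue measure on the interval `(a, b)`. -/
abbrev volIoo (a b : ℝ) : Measure ℝ := volume.restrict (Ioo a b)

/-! ### Riemann-Liouville fractional operators -/

/-- The left Riemann-Liouville fractional integral of order `β` with inferior limit `a`. -/
def leftFracInt {d : ℕ} (a β : ℝ) (f : ℝ → Rd d) (t : ℝ) : Rd d :=
  (1 / Real.Gamma β) • ∫ ξ in a..t, (t - ξ) ^ (β - 1) • f ξ

/-- The right Riemann-Liouville fractional integral of order `β` with superior limit `b`. -/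
def rightFracInt {d : ℕ} (b β : ℝ) (f : ℝ → Rd d) (t : ℝ) : Rd d :=
  (1 / Real.Gamma β) • ∫ ξ in t..b, (ξ - t) ^ (β - 1) • f ξ

/-- The integral defining `leftFracInt a β f t` converges. -/
def LeftFracIntExists {d : ℕ} (a β : ℝ) (f : ℝ → Rd d) (t : ℝ) : Prop :=
  IntervalIntegrable (fun ξ => (t - ξ) ^ (β - 1) • f ξ) volume a t

/-- The integral defining `rightFracInt b β f t` converges. -/
def RightFracIntExists {d : ℕ} (b β : ℝ) (f : ℝ → Rd d) (t : ℝ) : Prop :=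
  IntervalIntegrable (fun ξ => (ξ - t) ^ (β - 1) • f ξ) volume t b

/-- The left Riemann-Liouville fractional derivative of order `α`. -/
def leftFracDeriv {d : ℕ} (a α : ℝ) (f : ℝ → Rd d) (t : ℝ) : Rd d :=
  deriv (leftFracInt a (1 - α) f) t

/-- The right Riemann-Liouville fractional derivative of order `α`. -/
def rightFracDeriv {d : ℕ} (b α : ℝ) (f : ℝ → Rd d) (t : ℝ) : Rd d :=
  -deriv (rightFracInt b (1 - α) f) t

/-- The left fractional derivative of `f` is defined at `t`: the fractional integral of order
`1 - α` converges near `t` and is differentiable at `t`. -/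
def LeftFracDerivExists {d : ℕ} (a α : ℝ) (f : ℝ → Rd d) (t : ℝ) : Prop :=
  (∀ᶠ s in 𝓝 t, LeftFracIntExists a (1 - α) f s) ∧
    DifferentiableAt ℝ (leftFracInt a (1 - α) f) t

/-- The right fractional derivative of `f` is defined at `t`. -/
def RightFracDerivExists {d : ℕ} (b α : ℝ) (f : ℝ → Rd d) (t : ℝ) : Prop :=
  (∀ᶠ s in 𝓝 t, RightFracIntExists b (1 - α) f s) ∧
    DifferentiableAt ℝ (rightFracInt b (1 - α) f) t

/-! ### The space `E_{α,p}` -/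

/-- (Representatives of) the elements of `E_{α,p}`: functions `u ∈ L^p(a,b; ℝ^d)` whose left
fractional derivative is defined almost everywhere, belongs to `L^p`, and satisfies
`I^α_- D^α_- u = u` almost everywhere. Values outside `(a, b)` and on null sets play no role. -/
def fracSpace (d : ℕ) (a b α p : ℝ) : Set (ℝ → Rd d) :=
  {u | MemLp u (ENNReal.ofReal p) (volIoo a b) ∧
    (∀ᵐ t ∂volIoo a b, LeftFracDerivExists a α u t) ∧
    MemLp (leftFracDeriv a α u) (ENNReal.ofReal p) (volIoo a b) ∧
    leftFracInt a α (leftFracDeriv a α u) =ᵐ[volIoo a b] u}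

/-! ### The Lagrangian -/

/-- The partial derivative (as a gradient) of `L` in its first variable. -/
def partialX {d : ℕ} (L : Rd d → Rd d → ℝ → ℝ) (x y : Rd d) (t : ℝ) : Rd d :=
  gradient (fun x' => L x' y t) x

/-- The partial derivative (as a gradient) of `L` in its second variable. -/
def partialY {d : ℕ} (L : Rd d → Rd d → ℝ → ℝ) (x y : Rd d) (t : ℝ) : Rd d :=
  gradient (fun y' => L x y' t) y

/-- `L` is of class `C^1` on `ℝ^d × ℝ^d × [a, b]`. -/
def IsC1Lagrangian {d : ℕ} (a b : ℝ) (L : Rd d → Rd d → ℝ → ℝ) : Prop :=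
  ContDiffOn ℝ 1 (fun z : Rd d × Rd d × ℝ => L z.1 z.2.1 z.2.2) (univ ×ˢ univ ×ˢ Icc a b)

/-- The growth bound `g(x,y,t) ≤ r(x,t) ‖y‖^δ + s(x,t)` on `ℝ^d × ℝ^d × [a,b]`, for some
`0 ≤ δ ≤ m` and some continuous nonnegative `r`, `s` on `ℝ^d × [a,b]`. -/
def GrowthBound {d : ℕ} (a b m : ℝ) (g : Rd d → Rd d → ℝ → ℝ) : Prop :=
  ∃ δ : ℝ, 0 ≤ δ ∧ δ ≤ m ∧ ∃ r s : Rd d → ℝ → ℝ,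
    ContinuousOn (fun z : Rd d × ℝ => r z.1 z.2) (univ ×ˢ Icc a b) ∧
    ContinuousOn (fun z : Rd d × ℝ => s z.1 z.2) (univ ×ˢ Icc a b) ∧
    (∀ x, ∀ t ∈ Icc a b, 0 ≤ r x t) ∧ (∀ x, ∀ t ∈ Icc a b, 0 ≤ s x t) ∧
    ∀ x y, ∀ t ∈ Icc a b, g x y t ≤ r x t * ‖y‖ ^ δ + s x t

/-- The coercivity condition
`L(x,y,t) ≥ c₁(x,t) ‖y‖^p + c₂(t) ‖x‖^δ + c₃(t)` with `c₁ ≥ γ > 0` and `1 ≤ δ < p`. -/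
def CoerciveLagrangian {d : ℕ} (a b p : ℝ) (L : Rd d → Rd d → ℝ → ℝ) : Prop :=
  ∃ γ δ : ℝ, 0 < γ ∧ 1 ≤ δ ∧ δ < p ∧ ∃ (c₁ : Rd d → ℝ → ℝ) (c₂ c₃ : ℝ → ℝ),
    ContinuousOn (fun z : Rd d × ℝ => c₁ z.1 z.2) (univ ×ˢ Icc a b) ∧
    (∀ x, ∀ t ∈ Icc a b, γ ≤ c₁ x t) ∧
    ContinuousOn c₂ (Icc a b) ∧ ContinuousOn c₃ (Icc a b) ∧
    ∀ x y, ∀ t ∈ Icc a b, c₁ x t * ‖y‖ ^ p + c₂ t * ‖x‖ ^ δ + c₃ t ≤ L x y t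

/-- For every `t ∈ [a,b]`, the map `L(·,·,t)` is (jointly) convex. -/
def ConvexLagrangian {d : ℕ} (a b : ℝ) (L : Rd d → Rd d → ℝ → ℝ) : Prop :=
  ∀ t ∈ Icc a b, ConvexOn ℝ univ (fun z : Rd d × Rd d => L z.1 z.2 t)

/-- The integrand `t ↦ L(u(t), D^α_- u(t), t)`. -/
def lagrangianIntegrand {d : ℕ} (a α : ℝ) (L : Rd d → Rd d → ℝ → ℝ) (u : ℝ → Rd d) (t : ℝ) : ℝ :=
  L (u t) (leftFracDeriv a α u t) t

/-- The Lagrangian functional `∫_a^b L(u, D^α_- u, t) dt`. -/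
def lagrangianFunctional {d : ℕ} (a b α : ℝ) (L : Rd d → Rd d → ℝ → ℝ) (u : ℝ → Rd d) : ℝ :=
  ∫ t in a..b, lagrangianIntegrand a α L u t

/-- Weak solution of the fractional Euler-Lagrange equation: `u` is continuous on `[a,b]` and,
for almost every `t`, the fractional derivatives involved are defined and
`∂_x L(u, D^α_- u, t) + D^α_+ (∂_y L(u, D^α_- u, ·))(t) = 0`. -/
def IsWeakSolution {d : ℕ} (a b α : ℝ) (L : Rd d → Rd d → ℝ → ℝ) (u : ℝ → Rd d) : Prop :=
  ContinuousOn u (Icc a b) ∧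
    ∀ᵐ t ∂volIoo a b,
      LeftFracDerivExists a α u t ∧
      RightFracDerivExists b α (fun s => partialY L (u s) (leftFracDeriv a α u s) s) t ∧
      partialX L (u t) (leftFracDeriv a α u t) t +
        rightFracDeriv b α (fun s => partialY L (u s) (leftFracDeriv a α u s) s) t = 0

end

/-! The substitution `φ = D^α_- u`, `u = I^α_- φ` identifies `E_{α,p}` with `L^p` up to null sets
(`leftFracDeriv_leftFracInt`, `leftFracInt_mem_fracSpace`). It turns the problem into minimizing the
`reducedFunctional` `F(φ) = ∫ L(I^α_- φ, φ, t) dt` over all of `L^p`. Since `α > 1/p`, the kernel of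
`I^α_-` lies in the dual Lebesgue space. Hölder's inequality then makes `I^α_-` bounded from `L^p`
to the continuous functions, so states stay in a ball and the growth conditions make every integral
finite.

Existence is the direct method without weak topologies. Coercivity, with `d_4 < p`, bounds the
sublevel sets of `F` in `L^p`, and convexity makes them midpoint convex. In a decreasing sequence of
such sets, near-minimizers of the strictly convex functional `∫ √(1 + ‖φ‖²)` form a Cauchy sequence
in `L¹` (`exists_tendsto_of_antitone_midpoint_convex`). A subsequence of controls and states
converges almost everywhere, and Fatou's lemma shows that the limit minimizes `F`
(`exists_isMinOn_reducedFunctional`).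

For the equation, put `A = ∂_x L` and `B = ∂_y L` along the minimizer. Differentiating `F` in
bounded directions `h` and moving `I^α_-` from `h` to `A` by fractional integration by parts
(`integral_inner_leftFracInt`) gives `I^α_+ A + B = 0` almost everywhere. Applying `I^{1-α}_+` gives
`I^{1-α}_+ B = -∫_t^b A`, and differentiation yields `D^α_+ B = -A`
(`rightFracDeriv_of_rightFracInt_add_eq_zero`). -/

/-! ### Kernel operators on `L¹`. -/

section Kernel

variable {X Y E : Type*} [MeasurableSpace X] [MeasurableSpace Y] [NormedAddCommGroup E]
  [NormedSpace ℝ E]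

/-- Schur test in `L¹`: integrability on the product. -/
theorem integrable_prod_kernel_smul {μ : Measure X} {ν : Measure Y} [SFinite μ] [SFinite ν]
    {k : X → Y → ℝ} {C : ℝ} (hk : Measurable (Function.uncurry k))
    (hki : ∀ᵐ y ∂ν, Integrable (fun x => k x y) μ) (hC : ∀ᵐ y ∂ν, ∫ x, |k x y| ∂μ ≤ C)
    {f : Y → E} (hf : Integrable f ν) :
    Integrable (fun z : X × Y => k z.1 z.2 • f z.2) (μ.prod ν) := by
  have hm : AEStronglyMeasurable (fun z : X × Y => k z.1 z.2 • f z.2) (μ.prod ν) :=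
    hk.aestronglyMeasurable.smul hf.aestronglyMeasurable.comp_snd
  refine (integrable_prod_iff' hm).2 ⟨?_, ?_⟩
  · filter_upwards [hki] with y hy using hy.smul_const _
  · refine (hf.norm.const_mul C).mono' hm.prod_swap.norm.integral_prod_right' ?_
    filter_upwards [hC] with y hy
    rw [Real.norm_of_nonneg (integral_nonneg fun _ => norm_nonneg _)]
    simp only [norm_smul, Real.norm_eq_abs]
    rw [integral_mul_const]
    gcongr

theorem integral_norm_kernel_smul_le {μ : Measure X} {ν : Measure Y} [SFinite μ] [SFinite ν]
    {k : X → Y → ℝ} {C : ℝ} (hk : Measurable (Function.uncurry k))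
    (hki : ∀ᵐ y ∂ν, Integrable (fun x => k x y) μ) (hC : ∀ᵐ y ∂ν, ∫ x, |k x y| ∂μ ≤ C)
    {f : Y → E} (hf : Integrable f ν) :
    ∫ x, ‖∫ y, k x y • f y ∂ν‖ ∂μ ≤ C * ∫ y, ‖f y‖ ∂ν := by
  have hi := integrable_prod_kernel_smul hk hki hC hf
  calc ∫ x, ‖∫ y, k x y • f y ∂ν‖ ∂μ ≤ ∫ x, ∫ y, ‖k x y • f y‖ ∂ν ∂μ :=
        integral_mono_of_nonneg (Eventually.of_forall fun _ => norm_nonneg _)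
          hi.norm.integral_prod_left
          (Eventually.of_forall fun _ => norm_integral_le_integral_norm _)
    _ = ∫ y, ∫ x, ‖k x y • f y‖ ∂μ ∂ν := integral_integral_swap hi.norm
    _ ≤ ∫ y, C * ‖f y‖ ∂ν := by
        refine integral_mono_of_nonneg
          (Eventually.of_forall fun _ => integral_nonneg fun _ => norm_nonneg _)
          (hf.norm.const_mul C) ?_
        filter_upwards [hC] with y hy
        simp only [norm_smul, Real.norm_eq_abs]
        rw [integral_mul_const]
        gcongr
    _ = C * ∫ y, ‖f y‖ ∂ν := integral_const_mul _ _

end Kernel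

/-! ### Power kernels and Beta integrals. -/

/-- The power kernel `s ↦ s ^ r` restricted to `(0, δ)`. -/
noncomputable def powKer (δ r : ℝ) : ℝ → ℝ := (Ioo 0 δ).indicator fun s => s ^ r

theorem measurable_powKer (δ r : ℝ) : Measurable (powKer δ r) :=
  (measurable_id.pow_const r).indicator measurableSet_Ioo

theorem powKer_nonneg (δ r s : ℝ) : 0 ≤ powKer δ r s :=
  indicator_nonneg (fun _ hs => Real.rpow_nonneg hs.1.le _) _

theorem powKer_rpow {δ r q : ℝ} (hq : q ≠ 0) (s : ℝ) :
    powKer δ r s ^ q = powKer δ (r * q) s := by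
  by_cases hs : s ∈ Ioo 0 δ
  · simp [powKer, hs, Real.rpow_mul hs.1.le]
  · simp [powKer, hs, Real.zero_rpow hq]

theorem integrable_powKer {δ r : ℝ} (hδ : 0 ≤ δ) (hr : -1 < r) : Integrable (powKer δ r) := by
  refine (integrable_indicator_iff measurableSet_Ioo).2 ?_
  have := intervalIntegral.intervalIntegrable_rpow' (a := 0) (b := δ) hr
  exact ((intervalIntegrable_iff_integrableOn_Ioo_of_le hδ).1 this)

theorem integral_powKer {δ r : ℝ} (hδ : 0 ≤ δ) (hr : -1 < r) :
    ∫ s, powKer δ r s = δ ^ (r + 1) / (r + 1) := by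
  rw [powKer, integral_indicator measurableSet_Ioo, ← integral_Ioc_eq_integral_Ioo,
    ← intervalIntegral.integral_of_le hδ, integral_rpow (Or.inl hr),
    Real.zero_rpow (by linarith), sub_zero]

theorem setIntegral_powKer_sub_le {δ r : ℝ} (hδ : 0 ≤ δ) (hr : -1 < r) (S : Set ℝ) (t : ℝ) :
    ∫ ξ in S, powKer δ r (t - ξ) ≤ δ ^ (r + 1) / (r + 1) := by
  rw [← integral_powKer hδ hr, ← integral_sub_left_eq_self (powKer δ r) volume t]
  exact setIntegral_le_integral ((integrable_powKer hδ hr).comp_sub_left t)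
    (Eventually.of_forall fun _ => powKer_nonneg _ _ _)

theorem setIntegral_powKer_sub_le' {δ r : ℝ} (hδ : 0 ≤ δ) (hr : -1 < r) (S : Set ℝ) (t : ℝ) :
    ∫ ξ in S, powKer δ r (ξ - t) ≤ δ ^ (r + 1) / (r + 1) := by
  rw [← integral_powKer hδ hr, ← integral_sub_right_eq_self (powKer δ r) t]
  exact setIntegral_le_integral ((integrable_powKer hδ hr).comp_sub_right t)
    (Eventually.of_forall fun _ => powKer_nonneg _ _ _)

theorem integral_rpow_mul_one_sub_rpow {u v : ℝ} (hu : 0 < u) (hv : 0 < v) :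
    IntervalIntegrable (fun x : ℝ => x ^ (u - 1) * (1 - x) ^ (v - 1)) volume 0 1 ∧
    ∫ x in (0 : ℝ)..1, x ^ (u - 1) * (1 - x) ^ (v - 1) =
      Real.Gamma u * Real.Gamma v / Real.Gamma (u + v) := by
  have hc := Complex.betaIntegral_convergent (u := u) (v := v) (by simpa) (by simpa)
  -- On `[0, 1]` both bases are nonnegative, so the complex powers in the Beta integral are real
  -- powers.
  have e : ∀ x ∈ uIcc (0 : ℝ) 1, (x : ℂ) ^ ((u : ℂ) - 1) * (1 - (x : ℂ)) ^ ((v : ℂ) - 1) =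
      ((x ^ (u - 1) * (1 - x) ^ (v - 1) : ℝ) : ℂ) := by
    intro x hx
    rw [uIcc_of_le zero_le_one] at hx
    push_cast [Complex.ofReal_cpow hx.1, Complex.ofReal_cpow (sub_nonneg.2 hx.2)]
    rfl
  refine ⟨?_, ?_⟩
  · have h := (hc.congr (fun x hx => e x (uIoc_subset_uIcc hx)))
    refine (intervalIntegrable_iff_integrableOn_Ioc_of_le zero_le_one).2 ?_
    have h' := ((intervalIntegrable_iff_integrableOn_Ioc_of_le zero_le_one).1 h).re
    simp only [RCLike.re_to_complex, Complex.ofReal_re] at h'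
    exact h'
  · have h := ProbabilityTheory.beta_eq_betaIntegralReal u v hu hv
    rw [Complex.betaIntegral, intervalIntegral.integral_congr e,
      intervalIntegral.integral_ofReal, Complex.ofReal_re] at h
    rw [← h, ProbabilityTheory.beta]

/-- For `ξ < s < t` both differences are below `t - ξ ≤ δ`, so the cutoffs at `δ` are invisible; for
any other `s` one factor vanishes. -/
theorem powKer_mul_powKer {δ c s t ξ : ℝ} (htξ : t - ξ ≤ δ) :
    powKer δ (-c) (t - s) * powKer δ (c - 1) (s - ξ) =
      (Ioo ξ t).indicator (fun s => (s - ξ) ^ (c - 1) * (t - s) ^ (-c)) s := by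
  by_cases hs : s ∈ Ioo ξ t
  · have h1 : t - s ∈ Ioo 0 δ := ⟨by linarith [hs.2], by linarith [hs.1]⟩
    have h2 : s - ξ ∈ Ioo 0 δ := ⟨by linarith [hs.1], by linarith [hs.2]⟩
    simp [powKer, indicator_of_mem h1, indicator_of_mem h2, indicator_of_mem hs, mul_comm]
  · rw [indicator_of_notMem hs]
    rcases not_and_or.1 hs with h | h
    · rw [powKer, powKer, indicator_of_notMem (s := Ioo 0 δ) (a := s - ξ), mul_zero]
      exact fun h' => h (by linarith [h'.1])
    · rw [powKer, powKer, indicator_of_notMem (s := Ioo 0 δ) (a := t - s), zero_mul]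
      exact fun h' => h (by linarith [h'.1])

/-- Rescaling `[ξ, t]` to `[0, 1]` gives a Beta integral. The exponents add up to `-1`, so the power
of the length cancels the Jacobian and the value does not depend on `ξ` or `t`. -/
theorem integral_sub_rpow_mul_sub_rpow {c ξ t : ℝ} (hc0 : 0 < c) (hc1 : c < 1) (h : ξ < t) :
    IntervalIntegrable (fun s : ℝ => (s - ξ) ^ (c - 1) * (t - s) ^ (-c)) volume ξ t ∧
    ∫ s in ξ..t, (s - ξ) ^ (c - 1) * (t - s) ^ (-c) = Real.Gamma c * Real.Gamma (1 - c) := by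
  obtain ⟨h1, h2⟩ := integral_rpow_mul_one_sub_rpow hc0 (sub_pos.2 hc1)
  set l := t - ξ with hl
  have hl0 : 0 < l := sub_pos.2 h
  have e : EqOn (fun s : ℝ => (s - ξ) ^ (c - 1) * (t - s) ^ (-c))
      (fun s => l⁻¹ * ((s / l - ξ / l) ^ (c - 1) * (1 - (s / l - ξ / l)) ^ (1 - c - 1)))
      (uIcc ξ t) := by
    intro s hs
    rw [uIcc_of_le h.le] at hs
    have e1 : s - ξ = l * (s / l - ξ / l) := by field_simp
    have e2 : t - s = l * (1 - (s / l - ξ / l)) := by field_simp; rw [hl]; ring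
    have p1 : 0 ≤ s / l - ξ / l := by rw [← sub_div]; exact div_nonneg (by linarith [hs.1]) hl0.le
    have p2 : 0 ≤ 1 - (s / l - ξ / l) := by
      rw [← mul_nonneg_iff_of_pos_left hl0, ← e2]; linarith [hs.2]
    simp only
    rw [e1, e2, Real.mul_rpow hl0.le p1, Real.mul_rpow hl0.le p2,
      show (1 - c - 1 : ℝ) = -c by ring]
    have : l ^ (c - 1) * l ^ (-c) = l⁻¹ := by
      rw [← Real.rpow_add hl0, show c - 1 + -c = (-1 : ℝ) by ring, Real.rpow_neg_one]
    rw [← this]; ring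
  have hll : t / l - ξ / l = 1 := by rw [← sub_div, ← hl, div_self hl0.ne']
  constructor
  · refine IntervalIntegrable.congr (fun s hs => (e (uIoc_subset_uIcc hs)).symm) ?_
    refine IntervalIntegrable.const_mul ?_ _
    have := (h1.comp_sub_right (ξ / l)).comp_mul_left (c := l⁻¹)
    simp only [div_eq_inv_mul, zero_add] at this ⊢
    convert this using 1
    · rw [← hll] at *; field_simp
    · have : (1 : ℝ) = t / l - ξ / l := hll.symm
      rw [this]; field_simp; ring
  · rw [intervalIntegral.integral_congr e, intervalIntegral.integral_const_mul,
      intervalIntegral.integral_comp_div_sub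
        (fun x : ℝ => x ^ (c - 1) * (1 - x) ^ (1 - c - 1)) hl0.ne', hll, sub_self, h2]
    simp [hl0.ne']

theorem integrable_powKer_mul_powKer {δ c ξ t : ℝ} (hc0 : 0 < c) (hc1 : c < 1) (h : t - ξ ≤ δ) :
    Integrable fun s => powKer δ (-c) (t - s) * powKer δ (c - 1) (s - ξ) := by
  simp_rw [powKer_mul_powKer h]
  rcases lt_or_ge ξ t with h' | h'
  · refine (integrable_indicator_iff measurableSet_Ioo).2 ?_
    exact (intervalIntegrable_iff_integrableOn_Ioo_of_le h'.le).1
      (integral_sub_rpow_mul_sub_rpow hc0 hc1 h').1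
  · simp [Ioo_eq_empty_of_le h']

theorem setIntegral_powKer_mul_powKer {a b δ c ξ t : ℝ} (hc0 : 0 < c) (hc1 : c < 1)
    (h : t - ξ ≤ δ) (hξ : a ≤ ξ) (ht : t ≤ b) :
    ∫ s in Ioo a b, powKer δ (-c) (t - s) * powKer δ (c - 1) (s - ξ) =
      (Iio t).indicator (fun _ => Real.Gamma c * Real.Gamma (1 - c)) ξ := by
  simp_rw [powKer_mul_powKer h]
  rcases lt_or_ge ξ t with h' | h'
  · rw [setIntegral_indicator measurableSet_Ioo, inter_eq_right.2 (Ioo_subset_Ioo hξ ht),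
      ← integral_Ioc_eq_integral_Ioo, ← intervalIntegral.integral_of_le h'.le,
      (integral_sub_rpow_mul_sub_rpow hc0 hc1 h').2, indicator_of_mem (mem_Iio.2 h')]
  · rw [indicator_of_notMem (by simpa using h')]
    simp [Ioo_eq_empty_of_le h']

/-! ### Fractional integrals: semigroup property, `L¹` bounds, integration by parts. -/

section FracInt

variable {d : ℕ} {a b t : ℝ}

/-- With cutoff `b - a` the kernel only encodes `ξ < t`. The moving domain `(a, t)` can thus be
traded for the fixed measure `volIoo a b`, which is the form Fubini's theorem needs. -/
theorem powKer_smul_eq_indicator_left (β : ℝ) (f : ℝ → Rd d) (ht : t ∈ Icc a b) {ξ : ℝ}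
    (hξ : ξ ∈ Ioo a b) :
    powKer (b - a) (β - 1) (t - ξ) • f ξ =
      (Ioo a t).indicator (fun ξ => (t - ξ) ^ (β - 1) • f ξ) ξ := by
  by_cases h : ξ < t
  · rw [indicator_of_mem (s := Ioo a t) ⟨hξ.1, h⟩, powKer, indicator_of_mem]
    exact ⟨by linarith, by linarith [ht.2, hξ.1]⟩
  · rw [indicator_of_notMem (fun h' => h h'.2), powKer, indicator_of_notMem, zero_smul]
    exact fun h' => h (by linarith [h'.1])

theorem powKer_smul_eq_indicator_right (β : ℝ) (f : ℝ → Rd d) (ht : t ∈ Icc a b) {ξ : ℝ}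
    (hξ : ξ ∈ Ioo a b) :
    powKer (b - a) (β - 1) (ξ - t) • f ξ =
      (Ioo t b).indicator (fun ξ => (ξ - t) ^ (β - 1) • f ξ) ξ := by
  by_cases h : t < ξ
  · rw [indicator_of_mem (s := Ioo t b) ⟨h, hξ.2⟩, powKer, indicator_of_mem]
    exact ⟨by linarith, by linarith [ht.1, hξ.2]⟩
  · rw [indicator_of_notMem (fun h' => h h'.1), powKer, indicator_of_notMem, zero_smul]
    exact fun h' => h (by linarith [h'.1])

theorem leftFracInt_eq (β : ℝ) (f : ℝ → Rd d) (ht : t ∈ Icc a b) :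
    leftFracInt a β f t =
      (1 / Real.Gamma β) • ∫ ξ, powKer (b - a) (β - 1) (t - ξ) • f ξ ∂volIoo a b := by
  rw [leftFracInt, setIntegral_congr_fun measurableSet_Ioo
    (fun ξ hξ => powKer_smul_eq_indicator_left β f ht hξ), setIntegral_indicator measurableSet_Ioo,
    inter_eq_right.2 (Ioo_subset_Ioo_right ht.2), intervalIntegral.integral_of_le ht.1,
    integral_Ioc_eq_integral_Ioo]

theorem rightFracInt_eq (β : ℝ) (f : ℝ → Rd d) (ht : t ∈ Icc a b) :
    rightFracInt b β f t =
      (1 / Real.Gamma β) • ∫ ξ, powKer (b - a) (β - 1) (ξ - t) • f ξ ∂volIoo a b := by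
  rw [rightFracInt, setIntegral_congr_fun measurableSet_Ioo
    (fun ξ hξ => powKer_smul_eq_indicator_right β f ht hξ), setIntegral_indicator measurableSet_Ioo,
    inter_eq_right.2 (Ioo_subset_Ioo_left ht.1), intervalIntegral.integral_of_le ht.2,
    integral_Ioc_eq_integral_Ioo]

theorem leftFracIntExists_iff (β : ℝ) (f : ℝ → Rd d) (ht : t ∈ Icc a b) :
    LeftFracIntExists a β f t ↔
      Integrable (fun ξ => powKer (b - a) (β - 1) (t - ξ) • f ξ) (volIoo a b) := by
  change _ ↔ IntegrableOn _ _ _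
  rw [LeftFracIntExists, integrableOn_congr_fun
    (fun ξ hξ => powKer_smul_eq_indicator_left β f ht hξ) measurableSet_Ioo,
    integrableOn_indicator_iff measurableSet_Ioo,
    inter_eq_left.2 (Ioo_subset_Ioo_right ht.2),
    intervalIntegrable_iff_integrableOn_Ioo_of_le ht.1]

theorem rightFracIntExists_iff (β : ℝ) (f : ℝ → Rd d) (ht : t ∈ Icc a b) :
    RightFracIntExists b β f t ↔
      Integrable (fun ξ => powKer (b - a) (β - 1) (ξ - t) • f ξ) (volIoo a b) := by
  change _ ↔ IntegrableOn _ _ _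
  rw [RightFracIntExists, integrableOn_congr_fun
    (fun ξ hξ => powKer_smul_eq_indicator_right β f ht hξ) measurableSet_Ioo,
    integrableOn_indicator_iff measurableSet_Ioo,
    inter_eq_left.2 (Ioo_subset_Ioo_left ht.1),
    intervalIntegrable_iff_integrableOn_Ioo_of_le ht.2]

theorem leftFracInt_congr {β : ℝ} {f g : ℝ → Rd d} (h : f =ᵐ[volIoo a b] g) (ht : t ∈ Icc a b) :
    leftFracInt a β f t = leftFracInt a β g t := by
  rw [leftFracInt_eq β f ht, leftFracInt_eq β g ht]
  congr 1
  exact integral_congr_ae (h.mono fun ξ hξ => by simp only [hξ])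

theorem rightFracInt_congr {β : ℝ} {f g : ℝ → Rd d} (h : f =ᵐ[volIoo a b] g) (ht : t ∈ Icc a b) :
    rightFracInt b β f t = rightFracInt b β g t := by
  rw [rightFracInt_eq β f ht, rightFracInt_eq β g ht]
  congr 1
  exact integral_congr_ae (h.mono fun ξ hξ => by simp only [hξ])

theorem rightFracIntExists_congr {β : ℝ} {f g : ℝ → Rd d} (h : f =ᵐ[volIoo a b] g)
    (ht : t ∈ Icc a b) : RightFracIntExists b β f t ↔ RightFracIntExists b β g t := by
  rw [rightFracIntExists_iff β f ht, rightFracIntExists_iff β g ht]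
  exact integrable_congr (h.mono fun ξ hξ => by simp only [hξ])

/-- The semigroup property for kernels whose composition is the indicator of `S`, up to a
constant. -/
theorem integral_kernel_comp {k₁ : ℝ → ℝ} {k₂ : ℝ → ℝ → ℝ} {S : Set ℝ} {C : ℝ} {f : ℝ → Rd d}
    (hS : MeasurableSet S) (hC : 0 ≤ C) (h₁ : Measurable k₁) (h₂ : Measurable (Function.uncurry k₂))
    (n₁ : ∀ s, 0 ≤ k₁ s) (n₂ : ∀ s ξ, 0 ≤ k₂ s ξ)
    (hi : ∀ ξ ∈ Ioo a b, Integrable (fun s => k₁ s * k₂ s ξ) (volIoo a b))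
    (he : ∀ ξ ∈ Ioo a b, ∫ s, k₁ s * k₂ s ξ ∂volIoo a b = S.indicator (fun _ => C) ξ)
    (hf : Integrable f (volIoo a b)) :
    Integrable (fun s => k₁ s • ∫ ξ, k₂ s ξ • f ξ ∂volIoo a b) (volIoo a b) ∧
    ∫ s, k₁ s • ∫ ξ, k₂ s ξ • f ξ ∂volIoo a b ∂volIoo a b =
      C • ∫ ξ in S, f ξ ∂volIoo a b := by
  have hk : Measurable (Function.uncurry fun s ξ => k₁ s * k₂ s ξ) :=
    (h₁.comp measurable_fst).mul h₂
  have hint := integrable_prod_kernel_smul (μ := volIoo a b) (ν := volIoo a b) (C := C) hk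
    ((ae_restrict_mem measurableSet_Ioo).mono hi)
    ((ae_restrict_mem measurableSet_Ioo).mono fun ξ hξ => by
      simp only [abs_of_nonneg (mul_nonneg (n₁ _) (n₂ _ _))]
      rw [he ξ hξ]
      exact indicator_le_self' (fun _ _ => hC) ξ) hf
  have e : ∀ s, k₁ s • ∫ ξ, k₂ s ξ • f ξ ∂volIoo a b = ∫ ξ, (k₁ s * k₂ s ξ) • f ξ ∂volIoo a b := by
    intro s
    rw [← integral_smul]
    simp only [smul_smul]
  simp only [e]
  refine ⟨hint.integral_prod_left, ?_⟩
  rw [integral_integral_swap hint, ← integral_smul, ← integral_indicator hS]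
  refine integral_congr_ae ((ae_restrict_mem measurableSet_Ioo).mono fun ξ hξ => ?_)
  simp only
  rw [integral_smul_const, he ξ hξ]
  by_cases h : ξ ∈ S <;> simp [h]

/-- The orders add up to `1`: the composed kernel is the constant `Γ(α)Γ(1-α)` on `ξ < t`, and the
two normalizations cancel it. -/
theorem leftFracInt_leftFracInt {α : ℝ} (h0 : 0 < α) (h1 : α < 1) {f : ℝ → Rd d}
    (hf : Integrable f (volIoo a b)) (ht : t ∈ Icc a b) :
    LeftFracIntExists a (1 - α) (leftFracInt a α f) t ∧
      leftFracInt a (1 - α) (leftFracInt a α f) t = ∫ ξ in a..t, f ξ := by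
  have hG : 0 < Real.Gamma α * Real.Gamma (1 - α) :=
    mul_pos (Real.Gamma_pos_of_pos h0) (Real.Gamma_pos_of_pos (sub_pos.2 h1))
  obtain ⟨hi, he⟩ := integral_kernel_comp (a := a) (b := b)
    (k₁ := fun s => powKer (b - a) (-α) (t - s)) (k₂ := fun s ξ => powKer (b - a) (α - 1) (s - ξ))
    (S := Iio t) measurableSet_Iio hG.le ((measurable_powKer _ _).comp (by fun_prop))
    ((measurable_powKer _ _).comp (by fun_prop)) (fun _ => powKer_nonneg _ _ _)
    (fun _ _ => powKer_nonneg _ _ _)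
    (fun ξ hξ => (integrable_powKer_mul_powKer h0 h1 (by linarith [hξ.1, ht.2])).restrict)
    (fun ξ hξ => setIntegral_powKer_mul_powKer h0 h1 (by linarith [hξ.1, ht.2]) hξ.1.le ht.2) hf
  have ec : (fun s => powKer (b - a) (1 - α - 1) (t - s) • leftFracInt a α f s) =ᵐ[volIoo a b]
      fun s => (1 / Real.Gamma α) • (powKer (b - a) (-α) (t - s) •
        ∫ ξ, powKer (b - a) (α - 1) (s - ξ) • f ξ ∂volIoo a b) := by
    refine (ae_restrict_mem measurableSet_Ioo).mono fun s hs => ?_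
    simp only
    rw [leftFracInt_eq α f (Ioo_subset_Icc_self hs), smul_comm, show 1 - α - 1 = -α by ring]
  constructor
  · rw [leftFracIntExists_iff _ _ ht]
    exact (integrable_congr ec).2 (hi.smul (1 / Real.Gamma α))
  · rw [leftFracInt_eq _ _ ht, integral_congr_ae ec, integral_smul, he, smul_smul, smul_smul,
      show 1 / Real.Gamma (1 - α) * (1 / Real.Gamma α) * (Real.Gamma α * Real.Gamma (1 - α)) = 1 by
        have := (Real.Gamma_pos_of_pos h0).ne'
        have := (Real.Gamma_pos_of_pos (sub_pos.2 h1)).ne'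
        field_simp, one_smul, Measure.restrict_restrict measurableSet_Iio,
      intervalIntegral.integral_of_le ht.1, integral_Ioc_eq_integral_Ioo]
    congr 2
    ext x
    simp only [mem_inter_iff, mem_Iio, mem_Ioo]
    exact ⟨fun h => ⟨h.2.1, h.1⟩, fun h => ⟨h.2, h.1, h.2.trans_le ht.2⟩⟩

theorem rightFracInt_rightFracInt {α : ℝ} (h0 : 0 < α) (h1 : α < 1) {f : ℝ → Rd d}
    (hf : Integrable f (volIoo a b)) (ht : t ∈ Icc a b) :
    RightFracIntExists b (1 - α) (rightFracInt b α f) t ∧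
      rightFracInt b (1 - α) (rightFracInt b α f) t = ∫ ξ in t..b, f ξ := by
  have h1' : 1 - (1 - α) = α := by ring
  have hG : 0 < Real.Gamma (1 - α) * Real.Gamma (1 - (1 - α)) := by
    rw [h1']
    exact mul_pos (Real.Gamma_pos_of_pos (sub_pos.2 h1)) (Real.Gamma_pos_of_pos h0)
  -- The Beta integral is reused with `c = 1 - α` and with `t`, `ξ` as lower and upper endpoints,
  -- which swaps the two kernel factors.
  have hα : -(1 - α) = α - 1 := by ring
  obtain ⟨hi, he⟩ := integral_kernel_comp (a := a) (b := b)
    (k₁ := fun s => powKer (b - a) (1 - α - 1) (s - t))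
    (k₂ := fun s ξ => powKer (b - a) (α - 1) (ξ - s))
    (S := Ioi t) measurableSet_Ioi hG.le ((measurable_powKer _ _).comp (by fun_prop))
    ((measurable_powKer _ _).comp (by fun_prop)) (fun _ => powKer_nonneg _ _ _)
    (fun _ _ => powKer_nonneg _ _ _)
    (fun ξ hξ => by
      simp_rw [mul_comm (powKer _ (1 - α - 1) _), ← hα]
      exact (integrable_powKer_mul_powKer (by linarith) (by linarith)
        (by linarith [hξ.2, ht.1])).restrict)
    (fun ξ hξ => by
      simp_rw [mul_comm (powKer _ (1 - α - 1) _), ← hα]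
      rw [setIntegral_powKer_mul_powKer (by linarith) (by linarith)
        (by linarith [hξ.2, ht.1]) ht.1 hξ.2.le]
      rfl) hf
  have ec : (fun s => powKer (b - a) (1 - α - 1) (s - t) • rightFracInt b α f s) =ᵐ[volIoo a b]
      fun s => (1 / Real.Gamma α) • (powKer (b - a) (1 - α - 1) (s - t) •
        ∫ ξ, powKer (b - a) (α - 1) (ξ - s) • f ξ ∂volIoo a b) := by
    refine (ae_restrict_mem measurableSet_Ioo).mono fun s hs => ?_
    simp only
    rw [rightFracInt_eq α f (Ioo_subset_Icc_self hs), smul_comm]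
  constructor
  · rw [rightFracIntExists_iff _ _ ht]
    exact (integrable_congr ec).2 (hi.smul (1 / Real.Gamma α))
  · rw [rightFracInt_eq _ _ ht, integral_congr_ae ec, integral_smul, he, smul_smul, smul_smul,
      h1', show 1 / Real.Gamma (1 - α) * (1 / Real.Gamma α) * (Real.Gamma (1 - α) * Real.Gamma α)
        = 1 by
        have := (Real.Gamma_pos_of_pos h0).ne'
        have := (Real.Gamma_pos_of_pos (sub_pos.2 h1)).ne'
        field_simp, one_smul, Measure.restrict_restrict measurableSet_Ioi,
      intervalIntegral.integral_of_le ht.2, integral_Ioc_eq_integral_Ioo]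
    congr 2
    ext x
    simp only [mem_inter_iff, mem_Ioi, mem_Ioo]
    exact ⟨fun h => ⟨h.1, h.2.2⟩, fun h => ⟨h.1, ht.1.trans_lt h.1, h.2⟩⟩

/-- `I^α_-` is bounded on `L¹`. -/
theorem integral_norm_leftFracInt_le {α : ℝ} (h0 : 0 < α) (hab : a ≤ b) :
    ∃ C : ℝ, ∀ f : ℝ → Rd d, Integrable f (volIoo a b) →
      Integrable (leftFracInt a α f) (volIoo a b) ∧
      ∫ t, ‖leftFracInt a α f t‖ ∂volIoo a b ≤ C * ∫ t, ‖f t‖ ∂volIoo a b := by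
  refine ⟨(1 / Real.Gamma α) * ((b - a) ^ (α - 1 + 1) / (α - 1 + 1)), fun f hf => ?_⟩
  have hk : Measurable (Function.uncurry fun s ξ => powKer (b - a) (α - 1) (s - ξ)) :=
    (measurable_powKer _ _).comp (by fun_prop)
  have hki : ∀ᵐ ξ ∂volIoo a b, Integrable (fun s => powKer (b - a) (α - 1) (s - ξ)) (volIoo a b) :=
    Eventually.of_forall fun ξ =>
      ((integrable_powKer (sub_nonneg.2 hab) (by linarith)).comp_sub_right ξ).restrict
  have hC : ∀ᵐ ξ ∂volIoo a b, ∫ s, |powKer (b - a) (α - 1) (s - ξ)| ∂volIoo a b ≤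
      (b - a) ^ (α - 1 + 1) / (α - 1 + 1) := Eventually.of_forall fun ξ => by
    simp only [abs_of_nonneg (powKer_nonneg _ _ _)]
    exact setIntegral_powKer_sub_le' (sub_nonneg.2 hab) (by linarith) _ _
  have ec : leftFracInt a α f =ᵐ[volIoo a b] fun s => (1 / Real.Gamma α) •
      ∫ ξ, powKer (b - a) (α - 1) (s - ξ) • f ξ ∂volIoo a b :=
    (ae_restrict_mem measurableSet_Ioo).mono fun s hs =>
      leftFracInt_eq α f (Ioo_subset_Icc_self hs)
  refine ⟨(integrable_congr ec).2
    ((integrable_prod_kernel_smul hk hki hC hf).integral_prod_left.smul (1 / Real.Gamma α)), ?_⟩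
  have hn := integral_congr_ae (ec.fun_comp norm)
  have hG := Real.Gamma_pos_of_pos h0
  simp only [Function.comp_def, norm_smul] at hn
  rw [hn, integral_const_mul, Real.norm_of_nonneg (by positivity), mul_assoc]
  gcongr
  exact integral_norm_kernel_smul_le hk hki hC hf

theorem integrable_rightFracInt {α : ℝ} (h0 : 0 < α) (hab : a ≤ b) {f : ℝ → Rd d}
    (hf : Integrable f (volIoo a b)) : Integrable (rightFracInt b α f) (volIoo a b) := by
  have hk : Measurable (Function.uncurry fun s ξ => powKer (b - a) (α - 1) (ξ - s)) :=
    (measurable_powKer _ _).comp (by fun_prop)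
  have ec : rightFracInt b α f =ᵐ[volIoo a b] fun s => (1 / Real.Gamma α) •
      ∫ ξ, powKer (b - a) (α - 1) (ξ - s) • f ξ ∂volIoo a b :=
    (ae_restrict_mem measurableSet_Ioo).mono fun s hs =>
      rightFracInt_eq α f (Ioo_subset_Icc_self hs)
  refine (integrable_congr ec).2
    ((integrable_prod_kernel_smul (C := (b - a) ^ (α - 1 + 1) / (α - 1 + 1)) hk ?_ ?_
      hf).integral_prod_left.smul (1 / Real.Gamma α))
  · exact Eventually.of_forall fun ξ =>
      ((integrable_powKer (sub_nonneg.2 hab) (by linarith)).comp_sub_left ξ).restrict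
  · refine Eventually.of_forall fun ξ => ?_
    simp only [abs_of_nonneg (powKer_nonneg _ _ _)]
    exact setIntegral_powKer_sub_le (sub_nonneg.2 hab) (by linarith) _ _

/-- Fractional integration by parts. -/
theorem integral_inner_leftFracInt {α : ℝ} (h0 : 0 < α) (hab : a ≤ b) {A h : ℝ → Rd d}
    (hA : Integrable A (volIoo a b)) (hh : AEStronglyMeasurable h (volIoo a b)) {C : ℝ}
    (hC : ∀ t, ‖h t‖ ≤ C) :
    ∫ t, inner ℝ (A t) (leftFracInt a α h t) ∂volIoo a b =
      ∫ t, inner ℝ (rightFracInt b α A t) (h t) ∂volIoo a b := by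
  have hδ : 0 ≤ b - a := sub_nonneg.2 hab
  have hk : Measurable (Function.uncurry fun s ξ => powKer (b - a) (α - 1) (ξ - s)) :=
    (measurable_powKer _ _).comp (by fun_prop)
  have hint := integrable_prod_kernel_smul (μ := volIoo a b) (ν := volIoo a b)
    (C := (b - a) ^ (α - 1 + 1) / (α - 1 + 1)) hk
    (Eventually.of_forall fun ξ =>
      ((integrable_powKer hδ (by linarith)).comp_sub_left ξ).restrict)
    (Eventually.of_forall fun ξ => by
      simp only [abs_of_nonneg (powKer_nonneg _ _ _)]
      exact setIntegral_powKer_sub_le hδ (by linarith) _ _) hA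
  have hint2 : Integrable (fun z : ℝ × ℝ => inner ℝ (powKer (b - a) (α - 1) (z.2 - z.1) • A z.2)
      (h z.1)) ((volIoo a b).prod (volIoo a b)) := by
    refine (hint.norm.mul_const C).mono' (hint.aestronglyMeasurable.inner hh.comp_fst) ?_
    refine Eventually.of_forall fun z => (norm_inner_le_norm _ _).trans ?_
    exact mul_le_mul_of_nonneg_left (hC _) (norm_nonneg _)
  have hsw := integral_integral_swap (f := fun x y => inner ℝ (powKer (b - a) (α - 1) (y - x) • A y) (h x))
    hint2
  have hbd : ∀ t, Integrable (fun ξ => powKer (b - a) (α - 1) (t - ξ) • h ξ) (volIoo a b) := by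
    intro t
    have hi := ((integrable_powKer hδ (by linarith : -1 < α - 1)).comp_sub_left t).restrict
      (s := Ioo a b)
    refine (hi.norm.mul_const C).mono' (hi.aestronglyMeasurable.smul hh) ?_
    refine Eventually.of_forall fun z => (norm_smul _ _).le.trans ?_
    exact mul_le_mul_of_nonneg_left (hC _) (norm_nonneg _)
  -- Both sides are iterated integrals of the same double integral: integrating first in `x`
  -- produces `I^α_- h`, first in `y` produces `I^α_+ A`.
  have e1 : ∫ t, inner ℝ (A t) (leftFracInt a α h t) ∂volIoo a b = (1 / Real.Gamma α) *
      ∫ y, ∫ x, inner ℝ (powKer (b - a) (α - 1) (y - x) • A y) (h x) ∂volIoo a b ∂volIoo a b := by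
    rw [← integral_const_mul]
    refine integral_congr_ae ((ae_restrict_mem measurableSet_Ioo).mono fun t ht => ?_)
    simp only
    rw [leftFracInt_eq α h (Ioo_subset_Icc_self ht), inner_smul_right, ← integral_inner (hbd t)]
    simp only [inner_smul_left, inner_smul_right, RCLike.conj_to_real]
  have e2 : ∫ t, inner ℝ (rightFracInt b α A t) (h t) ∂volIoo a b = (1 / Real.Gamma α) *
      ∫ x, ∫ y, inner ℝ (powKer (b - a) (α - 1) (y - x) • A y) (h x) ∂volIoo a b ∂volIoo a b := by
    rw [← integral_const_mul]
    refine integral_congr_ae ?_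
    filter_upwards [ae_restrict_mem measurableSet_Ioo, hint.prod_right_ae] with t ht hi
    rw [rightFracInt_eq α A (Ioo_subset_Icc_self ht), inner_smul_left, RCLike.conj_to_real,
      real_inner_comm, ← integral_inner hi]
    simp only [real_inner_comm]
  rw [e1, e2, hsw]

end FracInt

/-! ### Hölder estimates and continuity of `I^α_-` on `L^p`. -/

/-- With `q = p / (p - 1)` this is `α p > 1` rewritten: the condition `1 / p < α` is what puts the
kernel in `L^q`. -/
theorem powKer_exponent_gt {α p : ℝ} (hp : 1 < p) (hpα : 1 / p < α) :
    -1 < (α - 1) * p.conjExponent := by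
  have h : 0 < p - 1 := by linarith
  have h' : 1 < α * p := by rwa [div_lt_iff₀ (by linarith)] at hpα
  rw [Real.conjExponent, ← mul_div_assoc, lt_div_iff₀ h]
  nlinarith

theorem memLp_powKer_sub {δ α p : ℝ} (hδ : 0 ≤ δ) (hp : 1 < p) (hpα : 1 / p < α) (S : Set ℝ)
    (t : ℝ) : MemLp (fun ξ => powKer δ (α - 1) (t - ξ)) (ENNReal.ofReal p.conjExponent)
      (volume.restrict S) := by
  have hq := (Real.HolderConjugate.conjExponent hp).symm.pos
  have hm : Measurable fun ξ => powKer δ (α - 1) (t - ξ) :=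
    (measurable_powKer _ _).comp (by fun_prop)
  rw [← integrable_norm_rpow_iff hm.aestronglyMeasurable (by simpa using hq) (by simp)]
  rw [ENNReal.toReal_ofReal hq.le]
  simp only [Real.norm_of_nonneg (powKer_nonneg _ _ _), powKer_rpow hq.ne']
  exact ((integrable_powKer hδ (powKer_exponent_gt hp hpα)).comp_sub_left t).restrict

/-- Hölder's inequality against a kernel dominated by a power kernel. -/
theorem norm_integral_kernel_smul_le {d : ℕ} {δ α p : ℝ} (hδ : 0 ≤ δ) (hp : 1 < p)
    (hpα : 1 / p < α) (S : Set ℝ) (t : ℝ) {φ : ℝ → Rd d}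
    (hφ : MemLp φ (ENNReal.ofReal p) (volume.restrict S)) {k : ℝ → ℝ} (hk : Measurable k)
    (hk1 : ∀ ξ, |k ξ| ≤ powKer δ (α - 1) (t - ξ)) :
    Integrable (fun ξ => k ξ • φ ξ) (volume.restrict S) ∧
    ‖∫ ξ in S, k ξ • φ ξ‖ ≤
      (δ ^ ((α - 1) * p.conjExponent + 1) / ((α - 1) * p.conjExponent + 1)) ^
        (1 / p.conjExponent) * (∫ ξ in S, ‖φ ξ‖ ^ p) ^ (1 / p) := by
  have hpq := (Real.HolderConjugate.conjExponent hp).symm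
  have hker := memLp_powKer_sub hδ hp hpα S t
  have hr := powKer_exponent_gt hp hpα
  have hint : Integrable (fun ξ => ‖powKer δ (α - 1) (t - ξ)‖ * ‖φ ξ‖) (volume.restrict S) := by
    have : (ENNReal.ofReal p.conjExponent).HolderConjugate (ENNReal.ofReal p) :=
      hpq.ennrealOfReal
    exact hker.norm.integrable_mul hφ.norm
  have hle : ∀ ξ, ‖k ξ • φ ξ‖ ≤ ‖powKer δ (α - 1) (t - ξ)‖ * ‖φ ξ‖ := fun ξ => by
    rw [norm_smul, Real.norm_of_nonneg (powKer_nonneg _ _ _)]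
    exact mul_le_mul_of_nonneg_right (hk1 ξ) (norm_nonneg _)
  refine ⟨hint.mono' (hk.aestronglyMeasurable.smul hφ.1) (Eventually.of_forall hle), ?_⟩
  refine (norm_integral_le_of_norm_le hint (Eventually.of_forall hle)).trans ?_
  have hH := integral_mul_norm_le_Lp_mul_Lq hpq hker hφ.norm
  simp only [norm_norm (φ _)] at hH
  refine hH.trans ?_
  refine mul_le_mul_of_nonneg_right ?_
    (Real.rpow_nonneg (integral_nonneg fun _ => Real.rpow_nonneg (norm_nonneg _) _) _)
  simp only [Real.norm_of_nonneg (powKer_nonneg _ _ _), powKer_rpow hpq.pos.ne']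
  refine Real.rpow_le_rpow (integral_nonneg fun _ => powKer_nonneg _ _ _)
    (setIntegral_powKer_sub_le hδ hr S t) (by have := hpq.pos; positivity)

section

variable {d : ℕ} {a b α p : ℝ}

theorem leftFracIntExists_of_memLp (hp : 1 < p) (hpα : 1 / p < α) (hab : a ≤ b) {φ : ℝ → Rd d}
    (hφ : MemLp φ (ENNReal.ofReal p) (volIoo a b)) {t : ℝ} (ht : t ∈ Icc a b) :
    LeftFracIntExists a α φ t := by
  rw [leftFracIntExists_iff _ _ ht]
  exact (norm_integral_kernel_smul_le (sub_nonneg.2 hab) hp hpα _ t hφ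
    ((measurable_powKer _ _).comp (by fun_prop))
    (fun ξ => (abs_of_nonneg (powKer_nonneg _ _ _)).le)).1

theorem exists_norm_leftFracInt_le (d : ℕ) (hp : 1 < p) (hpα : 1 / p < α) (hab : a ≤ b) :
    ∃ C : ℝ, 0 ≤ C ∧ ∀ φ : ℝ → Rd d, MemLp φ (ENNReal.ofReal p) (volIoo a b) →
      ∀ t ∈ Icc a b, ‖leftFracInt a α φ t‖ ≤ C * (∫ ξ, ‖φ ξ‖ ^ p ∂volIoo a b) ^ (1 / p) := by
  have hα : 0 < α := lt_trans (by positivity) hpα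
  have hG := Real.Gamma_pos_of_pos hα
  have hr := powKer_exponent_gt hp hpα
  have hδ := sub_nonneg.2 hab
  refine ⟨1 / Real.Gamma α *
    ((b - a) ^ ((α - 1) * p.conjExponent + 1) / ((α - 1) * p.conjExponent + 1)) ^
        (1 / p.conjExponent), ?_, fun φ hφ t ht => ?_⟩
  · have : 0 < (α - 1) * p.conjExponent + 1 := by linarith
    positivity
  · rw [leftFracInt_eq _ _ ht, norm_smul, Real.norm_of_nonneg (by positivity), mul_assoc]
    gcongr
    exact (norm_integral_kernel_smul_le hδ hp hpα _ t hφ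
      ((measurable_powKer _ _).comp (by fun_prop))
      (fun ξ => (abs_of_nonneg (powKer_nonneg _ _ _)).le)).2

/-- A uniform limit as `ε → 0` of integrals with the continuous kernels `K ε`. The error kernel is
dominated by `powKer ε (α - 1)`, so Hölder's inequality bounds the error, uniformly in `t`, by a
positive power of `ε` times the `L^p` norm. -/
theorem continuousOn_leftFracInt (hp : 1 < p) (hpα : 1 / p < α) (hab : a < b) {φ : ℝ → Rd d}
    (hφ : MemLp φ (ENNReal.ofReal p) (volIoo a b)) :
    ContinuousOn (leftFracInt a α φ) (Icc a b) := by
  have hα : 0 < α := lt_trans (by positivity) hpα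
  have hδ := sub_pos.2 hab
  have hr := powKer_exponent_gt hp hpα
  have hq := (Real.HolderConjugate.conjExponent hp).symm.pos
  have hφ1 : Integrable φ (volIoo a b) := hφ.integrable (by simpa using hp.le)
  -- a continuous truncation of the kernel
  let K : ℝ → ℝ → ℝ := fun ε s => (max s 0) ^ α / max s ε
  have hKc : ∀ ε, 0 < ε → Continuous (K ε) := fun ε hε => by
    have c1 : Continuous fun s : ℝ => max s 0 := continuous_id.max continuous_const
    have c2 : Continuous fun s : ℝ => max s ε := continuous_id.max continuous_const
    exact (c1.rpow_const fun _ => Or.inr hα.le).div c2 fun s => (lt_max_of_lt_right hε).ne'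
  have hK0 : ∀ ε, 0 < ε → ∀ s, 0 ≤ K ε s := fun ε hε s =>
    div_nonneg (Real.rpow_nonneg (le_max_right _ _) _) (hε.le.trans (le_max_right _ _))
  have hcont : ∀ ε, 0 < ε → ContinuousOn
      (fun t => (1 / Real.Gamma α) • ∫ ξ, K ε (t - ξ) • φ ξ ∂volIoo a b) (Icc a b) := by
    intro ε hε
    suffices h : ContinuousOn (fun t => ∫ ξ, K ε (t - ξ) • φ ξ ∂volIoo a b) (Icc a b) from
      h.const_smul (1 / Real.Gamma α)
    refine continuousOn_of_dominated (bound := fun ξ => (b - a) ^ α / ε * ‖φ ξ‖) ?_ ?_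
      (hφ1.norm.const_mul _) ?_
    · exact fun t _ => ((hKc ε hε).comp (by fun_prop)).aestronglyMeasurable.smul hφ.1
    · intro t ht
      refine (ae_restrict_mem measurableSet_Ioo).mono fun ξ hξ => ?_
      rw [norm_smul, Real.norm_of_nonneg (hK0 ε hε _)]
      have h1 : max (t - ξ) 0 ≤ b - a := max_le (by linarith [ht.2, hξ.1]) hδ.le
      have h2 : ε ≤ max (t - ξ) ε := le_max_right _ _
      have h3 : 0 ≤ max (t - ξ) 0 := le_max_right _ _
      gcongr
      exact div_le_div₀ (by positivity) (Real.rpow_le_rpow h3 h1 hα.le) hε h2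
    · refine Eventually.of_forall fun ξ => Continuous.continuousOn ?_
      exact ((hKc ε hε).comp (by fun_prop)).smul continuous_const
  -- The kernels agree where `t - ξ ≥ ε`; for `0 < t - ξ < ε` the truncated one lies between `0` and
  -- the power.
  have hdiff : ∀ ε, 0 < ε → ∀ t ∈ Icc a b, ∀ ξ ∈ Ioo a b,
      |powKer (b - a) (α - 1) (t - ξ) - (Ioo 0 (b - a)).indicator (K ε) (t - ξ)| ≤
        powKer ε (α - 1) (t - ξ) := by
    intro ε hε t ht ξ hξ
    by_cases h : t - ξ ∈ Ioo 0 (b - a)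
    · have e1 : powKer (b - a) (α - 1) (t - ξ) = (t - ξ) ^ α / (t - ξ) := by
        rw [powKer, indicator_of_mem h, Real.rpow_sub_one h.1.ne']
      have e2 : K ε (t - ξ) = (t - ξ) ^ α / max (t - ξ) ε := by
        simp only [K, max_eq_left h.1.le]
      rw [indicator_of_mem h, e2]
      by_cases h' : t - ξ < ε
      · rw [max_eq_right h'.le]
        have e3 : powKer ε (α - 1) (t - ξ) = powKer (b - a) (α - 1) (t - ξ) := by
          rw [powKer, powKer, indicator_of_mem h, indicator_of_mem (s := Ioo 0 ε) ⟨h.1, h'⟩]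
        rw [e3, e1, abs_of_nonneg (sub_nonneg.2 ?_)]
        · exact sub_le_self _ (div_nonneg (Real.rpow_nonneg h.1.le _) hε.le)
        · exact div_le_div_of_nonneg_left (Real.rpow_nonneg h.1.le _) h.1 h'.le
      · rw [max_eq_left (not_lt.1 h'), e1, sub_self, abs_zero]
        exact powKer_nonneg _ _ _
    · rw [indicator_of_notMem h, powKer, indicator_of_notMem h, sub_zero, abs_zero]
      exact powKer_nonneg _ _ _
  have hKind : ∀ ε, ∀ t ∈ Icc a b, ∀ ξ ∈ Ioo a b,
      (Ioo 0 (b - a)).indicator (K ε) (t - ξ) = K ε (t - ξ) := by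
    intro ε t ht ξ hξ
    by_cases h : 0 < t - ξ
    · exact indicator_of_mem (s := Ioo 0 (b - a)) ⟨h, by linarith [ht.2, hξ.1]⟩ _
    · rw [indicator_of_notMem (fun h' => h h'.1)]
      simp only [K]
      rw [max_eq_right (not_lt.1 h), Real.zero_rpow hα.ne', zero_div]
  set N := (∫ ξ, ‖φ ξ‖ ^ p ∂volIoo a b) ^ (1 / p)
  set κ := (α - 1) * p.conjExponent + 1 with hκ
  have hκ0 : 0 < κ := by linarith
  have hbound : ∀ ε, 0 < ε → ∀ t ∈ Icc a b,
      ‖leftFracInt a α φ t - (1 / Real.Gamma α) • ∫ ξ, K ε (t - ξ) • φ ξ ∂volIoo a b‖ ≤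
        1 / Real.Gamma α * ((ε ^ κ / κ) ^ (1 / p.conjExponent) * N) := by
    intro ε hε t ht
    have hG := Real.Gamma_pos_of_pos hα
    -- The outer indicator is there because the Hölder lemma asks for the kernel bound at every `ξ`,
    -- while `hdiff` gives it on `(a, b)`.
    have hm : Measurable fun ξ => (Ioo a b).indicator (fun ξ => powKer (b - a) (α - 1) (t - ξ) -
        (Ioo 0 (b - a)).indicator (K ε) (t - ξ)) ξ :=
      (((measurable_powKer _ _).comp (by fun_prop)).sub
        (((hKc ε hε).measurable.indicator measurableSet_Ioo).comp
          (by fun_prop))).indicator measurableSet_Ioo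
    have key := (norm_integral_kernel_smul_le hε.le hp hpα (Ioo a b) t hφ hm (fun ξ => by
      by_cases h : ξ ∈ Ioo a b
      · rw [indicator_of_mem h]; exact hdiff ε hε t ht ξ h
      · rw [indicator_of_notMem h, abs_zero]; exact powKer_nonneg _ _ _)).2
    have i1 := (leftFracIntExists_iff _ _ ht).1 (leftFracIntExists_of_memLp hp hpα hab.le hφ ht)
    have i2 : Integrable (fun ξ => K ε (t - ξ) • φ ξ) (volIoo a b) := by
      refine (hφ1.norm.const_mul ((b - a) ^ α / ε)).mono'
        (((hKc ε hε).comp (by fun_prop)).aestronglyMeasurable.smul hφ.1) ?_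
      refine (ae_restrict_mem measurableSet_Ioo).mono fun ξ hξ => ?_
      rw [norm_smul, Real.norm_of_nonneg (hK0 ε hε _)]
      have h1 : max (t - ξ) 0 ≤ b - a := max_le (by linarith [ht.2, hξ.1]) hδ.le
      have h2 : ε ≤ max (t - ξ) ε := le_max_right _ _
      have h3 : 0 ≤ max (t - ξ) 0 := le_max_right _ _
      gcongr
      exact div_le_div₀ (by positivity) (Real.rpow_le_rpow h3 h1 hα.le) hε h2
    rw [leftFracInt_eq _ _ ht, ← smul_sub, norm_smul, Real.norm_of_nonneg (by positivity),
      ← integral_sub i1 i2]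
    gcongr
    refine le_trans (le_of_eq ?_) key
    congr 1
    refine setIntegral_congr_fun measurableSet_Ioo fun ξ hξ => ?_
    rw [indicator_of_mem hξ, hKind ε t ht ξ hξ, sub_smul]
  have hlim : Tendsto (fun ε : ℝ => 1 / Real.Gamma α * ((ε ^ κ / κ) ^ (1 / p.conjExponent) * N))
      (𝓝[>] 0) (𝓝 0) := by
    have hc : Continuous fun ε : ℝ =>
        1 / Real.Gamma α * ((ε ^ κ / κ) ^ (1 / p.conjExponent) * N) :=
      continuous_const.mul ((((continuous_id.rpow_const fun _ => Or.inr hκ0.le).div_const _).rpow_const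
        fun _ => Or.inr (by positivity)).mul continuous_const)
    have := (hc.tendsto 0).mono_left (nhdsWithin_le_nhds (s := Ioi 0))
    simpa [Real.zero_rpow hκ0.ne', Real.zero_rpow (inv_ne_zero hq.ne')] using this
  refine continuousOn_of_uniform_approx_of_continuousOn fun u hu => ?_
  obtain ⟨η, hη, hηu⟩ := Metric.mem_uniformity_dist.1 hu
  obtain ⟨ε, hε1, hε2⟩ := ((hlim.eventually (gt_mem_nhds hη)).and self_mem_nhdsWithin).exists
  refine ⟨_, hcont ε hε2, fun t ht => hηu ?_⟩
  rw [dist_eq_norm]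
  exact (hbound ε hε2 t ht).trans_lt hε1

/-- `I^α_-` maps `L^p` into `E_{α,p}` and `D^α_-` is its left inverse. -/
theorem leftFracDeriv_leftFracInt (hp : 1 < p) (hpα : 1 / p < α) (hα1 : α < 1) (hab : a < b)
    {φ : ℝ → Rd d} (hφ : MemLp φ (ENNReal.ofReal p) (volIoo a b)) :
    ∀ᵐ t ∂volIoo a b, LeftFracDerivExists a α (leftFracInt a α φ) t ∧
      leftFracDeriv a α (leftFracInt a α φ) t = φ t := by
  have hα : 0 < α := lt_trans (by positivity) hpα
  have hφ1 : Integrable φ (volIoo a b) := hφ.integrable (by simpa using hp.le)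
  have hii : IntervalIntegrable φ volume a b :=
    (intervalIntegrable_iff_integrableOn_Ioo_of_le hab.le).2 hφ1
  -- Near `t` the function `I^{1-α}_- I^α_- φ` is the primitive of `φ`, so Lebesgue's
  -- differentiation theorem concludes.
  have hae := ae_restrict_of_ae (s := Ioo a b) hii.ae_hasDerivAt_integral
  filter_upwards [hae, ae_restrict_mem measurableSet_Ioo] with t ht htm
  have hev : ∀ᶠ s in 𝓝 t, s ∈ Icc a b :=
    mem_of_superset (isOpen_Ioo.mem_nhds htm) Ioo_subset_Icc_self
  have htI : t ∈ uIcc a b := by rw [uIcc_of_le hab.le]; exact Ioo_subset_Icc_self htm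
  have hd := (ht htI a left_mem_uIcc).congr_of_eventuallyEq
    (hev.mono fun s hs => (leftFracInt_leftFracInt hα hα1 hφ1 hs).2)
  exact ⟨⟨hev.mono fun s hs => (leftFracInt_leftFracInt hα hα1 hφ1 hs).1, hd.differentiableAt⟩,
    hd.deriv⟩

theorem memLp_leftFracInt (hp : 1 < p) (hpα : 1 / p < α) (hab : a < b) {φ : ℝ → Rd d}
    (hφ : MemLp φ (ENNReal.ofReal p) (volIoo a b)) (q : ENNReal) :
    MemLp (leftFracInt a α φ) q (volIoo a b) := by
  have hc := continuousOn_leftFracInt hp hpα hab hφ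
  obtain ⟨C, _, hC⟩ := exists_norm_leftFracInt_le d hp hpα hab.le
  refine MemLp.of_bound ((hc.mono Ioo_subset_Icc_self).aestronglyMeasurable measurableSet_Ioo) _
    ((ae_restrict_mem measurableSet_Ioo).mono fun t ht => hC φ hφ t (Ioo_subset_Icc_self ht))

theorem leftFracInt_mem_fracSpace (hp : 1 < p) (hpα : 1 / p < α) (hα1 : α < 1) (hab : a < b)
    {φ : ℝ → Rd d} (hφ : MemLp φ (ENNReal.ofReal p) (volIoo a b)) :
    leftFracInt a α φ ∈ fracSpace d a b α p := by
  have h := leftFracDeriv_leftFracInt hp hpα hα1 hab hφ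
  have h2 : leftFracDeriv a α (leftFracInt a α φ) =ᵐ[volIoo a b] φ := h.mono fun t ht => ht.2
  refine ⟨memLp_leftFracInt hp hpα hab hφ _, h.mono fun t ht => ht.1, (memLp_congr_ae h2).2 hφ, ?_⟩
  exact (ae_restrict_mem measurableSet_Ioo).mono fun t ht =>
    leftFracInt_congr h2 (Ioo_subset_Icc_self ht)

end

/-! ### Quantitative strict convexity of `√(1 + ‖y‖²)`. -/

section Convexity

variable {E : Type*} [NormedAddCommGroup E] [InnerProductSpace ℝ E]

/-- A quantitative form of the strict convexity of `y ↦ √(1 + ‖y‖²)`. -/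
theorem norm_sub_sq_le_sqrt_one_add_sq (y z : E) :
    ‖y - z‖ ^ 2 ≤ (√(1 + ‖y‖ ^ 2) + √(1 + ‖z‖ ^ 2) - 2 * √(1 + ‖(1 / 2 : ℝ) • (y + z)‖ ^ 2)) *
      (√(1 + ‖y‖ ^ 2) + √(1 + ‖z‖ ^ 2)) ^ 3 := by
  -- `Y`, `Z`, `M` are the norms of `(1, y)`, `(1, z)` and their sum, and `1 + s` is the inner
  -- product of the two vectors. The claim bounds their Gram determinant by the deficit `Y + Z - M`
  -- in the triangle inequality.
  set Y := √(1 + ‖y‖ ^ 2) with hY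
  set Z := √(1 + ‖z‖ ^ 2) with hZ
  set M := 2 * √(1 + ‖(1 / 2 : ℝ) • (y + z)‖ ^ 2) with hM
  set s := inner ℝ y z with hs
  have hY1 : 1 ≤ Y := Real.one_le_sqrt.2 (by nlinarith [sq_nonneg ‖y‖])
  have hZ1 : 1 ≤ Z := Real.one_le_sqrt.2 (by nlinarith [sq_nonneg ‖z‖])
  have hM0 : 0 ≤ M := by positivity
  have hYsq : Y ^ 2 = 1 + ‖y‖ ^ 2 := Real.sq_sqrt (by positivity)
  have hZsq : Z ^ 2 = 1 + ‖z‖ ^ 2 := Real.sq_sqrt (by positivity)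
  have hMsq : M ^ 2 = 4 + (‖y‖ ^ 2 + 2 * s + ‖z‖ ^ 2) := by
    rw [hM, mul_pow, Real.sq_sqrt (by positivity), norm_smul, mul_pow, norm_add_sq_real]
    norm_num
    ring
  have hD : ‖y - z‖ ^ 2 = ‖y‖ ^ 2 - 2 * s + ‖z‖ ^ 2 := norm_sub_sq_real y z
  have hcs : s ^ 2 ≤ ‖y‖ ^ 2 * ‖z‖ ^ 2 := by
    rw [← mul_pow, sq_le_sq, abs_of_nonneg (by positivity : 0 ≤ ‖y‖ * ‖z‖)]
    exact abs_real_inner_le_norm y z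
  -- The right side equals `‖y - z‖² + (‖y‖²‖z‖² - s²)`.
  have hgram : ‖y - z‖ ^ 2 ≤ (Y * Z) ^ 2 - (1 + s) ^ 2 := by
    rw [hD, mul_pow, hYsq, hZsq]; nlinarith
  have h1s : |1 + s| ≤ Y * Z := by
    rw [← sq_le_sq₀ (abs_nonneg _) (by positivity), sq_abs]
    nlinarith [sq_nonneg ‖y - z‖]
  obtain ⟨hl, hr⟩ := abs_le.1 h1s
  have hMW : M ≤ Y + Z := by
    rw [← sq_le_sq₀ hM0 (by positivity)]; nlinarith
  have e1 : (Y + Z - M) * (Y + Z + M) = 2 * (Y * Z - (1 + s)) := by nlinarith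
  have e2 : Y * Z - (1 + s) ≤ (Y + Z - M) * (Y + Z) := by nlinarith
  have e3 : ‖y - z‖ ^ 2 ≤ (Y * Z - (1 + s)) * (2 * (Y * Z)) := by
    nlinarith [mul_nonneg (sub_nonneg.2 hr) (sub_nonneg.2 hr)]
  have e4 : 2 * (Y * Z) ≤ (Y + Z) ^ 2 := by nlinarith [sq_nonneg Y, sq_nonneg Z]
  calc ‖y - z‖ ^ 2 ≤ (Y * Z - (1 + s)) * (2 * (Y * Z)) := e3
    _ ≤ ((Y + Z - M) * (Y + Z)) * (Y + Z) ^ 2 :=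
        mul_le_mul e2 e4 (by positivity) (mul_nonneg (sub_nonneg.2 hMW) (by positivity))
    _ = _ := by ring

theorem sqrt_one_add_sq_midpoint_le (y z : E) :
    0 ≤ √(1 + ‖y‖ ^ 2) + √(1 + ‖z‖ ^ 2) - 2 * √(1 + ‖(1 / 2 : ℝ) • (y + z)‖ ^ 2) := by
  have h := (sq_nonneg ‖y - z‖).trans (norm_sub_sq_le_sqrt_one_add_sq y z)
  have hW : 0 < √(1 + ‖y‖ ^ 2) + √(1 + ‖z‖ ^ 2) := by positivity
  exact nonneg_of_mul_nonneg_left h (pow_pos hW 3)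

theorem sqrt_one_add_sq_le {E : Type*} [NormedAddCommGroup E] (y : E) : √(1 + ‖y‖ ^ 2) ≤ 1 + ‖y‖ := by
  rw [Real.sqrt_le_left (by positivity)]
  nlinarith [norm_nonneg y]

/-- If `2 + ‖y‖ + ‖z‖ ≤ N`, the cubic factor is at most `N³` and `r ≤ ε + r²/ε` applies. Otherwise
the difference is absorbed by the tail, as `r ≤ N^(1-p) r^p` for `r ≥ N`. Integrated, this turns
small convexity gaps and an `L^p` bound into smallness in `L¹`. -/
theorem norm_sub_le_of_sqrt_one_add_sq {p ε N : ℝ} (hp : 1 < p) (hε : 0 < ε) (hN : 0 < N)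
    (y z : E) : ‖y - z‖ ≤ ε + N ^ (1 - p) * (3 ^ p * (2 ^ p + ‖y‖ ^ p + ‖z‖ ^ p)) +
      N ^ 3 / ε *
        (√(1 + ‖y‖ ^ 2) + √(1 + ‖z‖ ^ 2) - 2 * √(1 + ‖(1 / 2 : ℝ) • (y + z)‖ ^ 2)) := by
  have hΔ := sqrt_one_add_sq_midpoint_le y z
  have hD := norm_sub_sq_le_sqrt_one_add_sq y z
  set Δ := √(1 + ‖y‖ ^ 2) + √(1 + ‖z‖ ^ 2) - 2 * √(1 + ‖(1 / 2 : ℝ) • (y + z)‖ ^ 2)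
  have hW : √(1 + ‖y‖ ^ 2) + √(1 + ‖z‖ ^ 2) ≤ 2 + ‖y‖ + ‖z‖ := by
    linarith [sqrt_one_add_sq_le y, sqrt_one_add_sq_le z]
  have hW0 : 0 ≤ √(1 + ‖y‖ ^ 2) + √(1 + ‖z‖ ^ 2) := by positivity
  set W := √(1 + ‖y‖ ^ 2) + √(1 + ‖z‖ ^ 2)
  have hp0 : 0 < p := by linarith
  have hQ : (2 + ‖y‖ + ‖z‖) ^ p ≤ 3 ^ p * (2 ^ p + ‖y‖ ^ p + ‖z‖ ^ p) := by
    have hy := norm_nonneg y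
    have hz := norm_nonneg z
    have h1 : 2 + ‖y‖ + ‖z‖ ≤ 3 * max 2 (max ‖y‖ ‖z‖) := by
      linarith [le_max_left 2 (max ‖y‖ ‖z‖), (le_max_left ‖y‖ ‖z‖).trans (le_max_right 2 _),
        (le_max_right ‖y‖ ‖z‖).trans (le_max_right 2 _)]
    have h2 : (max 2 (max ‖y‖ ‖z‖)) ^ p ≤ 2 ^ p + ‖y‖ ^ p + ‖z‖ ^ p := by
      have a1 : (0 : ℝ) ≤ 2 ^ p := by positivity
      have a2 : 0 ≤ ‖y‖ ^ p := by positivity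
      have a3 : 0 ≤ ‖z‖ ^ p := by positivity
      rcases max_choice 2 (max ‖y‖ ‖z‖) with h | h
      · rw [h]; linarith
      · rw [h]; rcases max_choice ‖y‖ ‖z‖ with h | h <;> rw [h] <;> linarith
    calc (2 + ‖y‖ + ‖z‖) ^ p ≤ (3 * max 2 (max ‖y‖ ‖z‖)) ^ p :=
          Real.rpow_le_rpow (by positivity) h1 hp0.le
      _ = 3 ^ p * (max 2 (max ‖y‖ ‖z‖)) ^ p := Real.mul_rpow (by norm_num) (by positivity)
      _ ≤ _ := by gcongr
  rcases le_or_gt (2 + ‖y‖ + ‖z‖) N with h | h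
  · have h1 : ‖y - z‖ ^ 2 ≤ Δ * N ^ 3 :=
      hD.trans (by gcongr; exact hW.trans h)
    have h2 : ‖y - z‖ ≤ ε + ‖y - z‖ ^ 2 / ε := by
      rw [← sub_le_iff_le_add', le_div_iff₀ hε]
      nlinarith [sq_nonneg (‖y - z‖ - ε), norm_nonneg (y - z)]
    have h3 : ‖y - z‖ ^ 2 / ε ≤ N ^ 3 / ε * Δ := by
      rw [div_mul_eq_mul_div, mul_comm]; gcongr
    have h4 : 0 ≤ N ^ (1 - p) * (3 ^ p * (2 ^ p + ‖y‖ ^ p + ‖z‖ ^ p)) := by positivity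
    linarith
  · have h0 : 0 < 2 + ‖y‖ + ‖z‖ := hN.trans h
    have h1 : 2 + ‖y‖ + ‖z‖ ≤ N ^ (1 - p) * (2 + ‖y‖ + ‖z‖) ^ p := by
      have : (2 + ‖y‖ + ‖z‖) ^ (1 - p) ≤ N ^ (1 - p) :=
        Real.rpow_le_rpow_of_nonpos hN h.le (by linarith)
      calc 2 + ‖y‖ + ‖z‖ = (2 + ‖y‖ + ‖z‖) ^ (1 - p) * (2 + ‖y‖ + ‖z‖) ^ p := by
            rw [← Real.rpow_add h0]; simp
        _ ≤ _ := by gcongr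
    have h2 : 0 ≤ N ^ 3 / ε * Δ := by positivity
    have h3 : N ^ (1 - p) * (2 + ‖y‖ + ‖z‖) ^ p ≤
        N ^ (1 - p) * (3 ^ p * (2 ^ p + ‖y‖ ^ p + ‖z‖ ^ p)) := by gcongr
    linarith [norm_sub_le y z]

end Convexity

/-! ### Strong `L¹` compactness from midpoint convexity. -/

section Compactness

variable {Ω E : Type*} [MeasurableSpace Ω] {μ : Measure Ω} [NormedAddCommGroup E]

theorem integrable_norm_rpow_of_memLp {p : ℝ} (hp : 0 < p) {φ : Ω → E}
    (hφ : MemLp φ (ENNReal.ofReal p) μ) : Integrable (fun t => ‖φ t‖ ^ p) μ := by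
  have := hφ.integrable_norm_rpow (by simpa using hp) (by simp)
  rwa [ENNReal.toReal_ofReal hp.le] at this

/-- A sequence which is Cauchy in `L¹` has an `L¹` limit, which is an almost everywhere limit along
a subsequence. -/
theorem exists_tendsto_integral_norm_sub [CompleteSpace E] {f : ℕ → Ω → E}
    (hf : ∀ n, Integrable (f n) μ)
    (hc : ∀ η > 0, ∃ n, ∀ i ≥ n, ∀ j ≥ n, ∫ t, ‖f i t - f j t‖ ∂μ < η) :
    ∃ F : Ω → E, Integrable F μ ∧ Tendsto (fun n => ∫ t, ‖f n t - F t‖ ∂μ) atTop (𝓝 0) ∧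
      ∃ ns : ℕ → ℕ, StrictMono ns ∧
        ∀ᵐ t ∂μ, Tendsto (fun n => f (ns n) t) atTop (𝓝 (F t)) := by
  have hd : ∀ i (g : Ω →₁[μ] E), dist ((hf i).toL1 (f i)) g = ∫ t, ‖f i t - g t‖ ∂μ := by
    intro i g
    rw [L1.dist_eq_integral_dist]
    refine integral_congr_ae ?_
    filter_upwards [(hf i).coeFn_toL1] with t ht
    rw [ht, dist_eq_norm]
  have hcs : CauchySeq fun n => (hf n).toL1 (f n) := by
    refine Metric.cauchySeq_iff.2 fun η hη => ?_
    obtain ⟨n, hn⟩ := hc η hη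
    refine ⟨n, fun i hi j hj => ?_⟩
    rw [hd]
    refine lt_of_eq_of_lt (integral_congr_ae ?_) (hn i hi j hj)
    filter_upwards [(hf j).coeFn_toL1] with t ht
    rw [ht]
  obtain ⟨F, hF⟩ := cauchySeq_tendsto_of_complete hcs
  obtain ⟨ns, hns, hae⟩ := (tendstoInMeasure_of_tendsto_Lp hF).exists_seq_tendsto_ae
  refine ⟨F, L1.integrable_coeFn F, ?_, ns, hns, ?_⟩
  · have := tendsto_iff_dist_tendsto_zero.1 hF
    simpa only [hd] using this
  · filter_upwards [hae, ae_all_iff.2 fun n => (hf n).coeFn_toL1] with t h1 h2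
    simpa only [h2] using h1

theorem memLp_of_tendsto_ae_of_integral_le {p R : ℝ} (hp : 0 < p) {f : ℕ → Ω → E} {F : Ω → E}
    (hf : ∀ n, MemLp (f n) (ENNReal.ofReal p) μ) (hR : ∀ n, ∫ t, ‖f n t‖ ^ p ∂μ ≤ R)
    (hlim : ∀ᵐ t ∂μ, Tendsto (fun n => f n t) atTop (𝓝 (F t))) :
    MemLp F (ENNReal.ofReal p) μ := by
  refine ⟨aestronglyMeasurable_of_tendsto_ae atTop (fun n => (hf n).1) hlim, ?_⟩
  refine (Lp.eLpNorm_lim_le_liminf_eLpNorm (fun n => (hf n).1) F hlim).trans_lt ?_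
  have hb : ∀ n, eLpNorm (f n) (ENNReal.ofReal p) μ ≤ ENNReal.ofReal (R ^ p⁻¹) := fun n => by
    rw [(hf n).eLpNorm_eq_integral_rpow_norm (by simpa using hp) (by simp),
      ENNReal.toReal_ofReal hp.le]
    exact ENNReal.ofReal_le_ofReal (Real.rpow_le_rpow
      (integral_nonneg fun _ => Real.rpow_nonneg (norm_nonneg _) _) (hR n) (by positivity))
  refine lt_of_le_of_lt (liminf_le_of_le (by isBoundedDefault) fun c hc => ?_)
    (ENNReal.ofReal_lt_top (r := R ^ p⁻¹))
  obtain ⟨n, hn⟩ := hc.exists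
  exact hn.trans (hb n)

variable [InnerProductSpace ℝ E] [CompleteSpace E] [IsFiniteMeasure μ]

/-- A decreasing sequence of nonempty midpoint-convex sets, bounded in `L^p` with `p > 1`, has a
selection which converges in `L¹` and almost everywhere to an element of `L^p`. -/
theorem exists_tendsto_of_antitone_midpoint_convex {p R : ℝ} (hp : 1 < p)
    {K : ℕ → Set (Ω → E)} (hanti : Antitone K) (hne : ∀ n, (K n).Nonempty)
    (hmem : ∀ φ ∈ K 0, MemLp φ (ENNReal.ofReal p) μ)
    (hR : ∀ φ ∈ K 0, ∫ t, ‖φ t‖ ^ p ∂μ ≤ R)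
    (hmid : ∀ n, ∀ φ ∈ K n, ∀ ψ ∈ K n, (fun t => (1 / 2 : ℝ) • (φ t + ψ t)) ∈ K n) :
    ∃ φ : Ω → E, MemLp φ (ENNReal.ofReal p) μ ∧ ∃ f : ℕ → Ω → E, (∀ n, f n ∈ K n) ∧
      Tendsto (fun n => ∫ t, ‖f n t - φ t‖ ∂μ) atTop (𝓝 0) ∧
      ∀ᵐ t ∂μ, Tendsto (fun n => f n t) atTop (𝓝 (φ t)) := by
  have hp0 : 0 < p := by linarith
  have hK0 : ∀ n, K n ⊆ K 0 := fun n => hanti (Nat.zero_le n)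
  have hL1 : ∀ φ ∈ K 0, Integrable φ μ := fun φ hφ =>
    (hmem φ hφ).integrable (by simpa using hp.le)
  have hLp : ∀ φ ∈ K 0, Integrable (fun t => ‖φ t‖ ^ p) μ := fun φ hφ =>
    integrable_norm_rpow_of_memLp hp0 (hmem φ hφ)
  -- The auxiliary `g` is strictly convex but of linear growth, so its integral is finite and
  -- bounded on `K 0`.
  let g : E → ℝ := fun y => √(1 + ‖y‖ ^ 2)
  have hgc : Continuous g := by fun_prop
  have hg0 : ∀ y, 0 ≤ g y := fun y => Real.sqrt_nonneg _
  have hgi : ∀ φ ∈ K 0, Integrable (fun t => g (φ t)) μ := fun φ hφ => by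
    refine ((integrable_const 1).add (hL1 φ hφ).norm).mono'
      (hgc.comp_aestronglyMeasurable (hmem φ hφ).1) (Eventually.of_forall fun t => ?_)
    rw [Real.norm_of_nonneg (hg0 _)]
    exact sqrt_one_add_sq_le _
  let G : (Ω → E) → ℝ := fun φ => ∫ t, g (φ t) ∂μ
  have hG0 : ∀ φ, 0 ≤ G φ := fun φ => integral_nonneg fun t => hg0 _
  have hGle : ∀ φ ∈ K 0, G φ ≤ 2 * μ.real univ + R := fun φ hφ => by
    calc G φ ≤ ∫ t, (2 + ‖φ t‖ ^ p) ∂μ := by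
          refine integral_mono (hgi φ hφ) ((integrable_const 2).add (hLp φ hφ)) fun t => ?_
          refine (sqrt_one_add_sq_le _).trans ?_
          rcases le_total ‖φ t‖ 1 with h | h
          · linarith [Real.rpow_nonneg (norm_nonneg (φ t)) p]
          · linarith [Real.self_le_rpow_of_one_le h hp.le]
      _ = 2 * μ.real univ + ∫ t, ‖φ t‖ ^ p ∂μ := by
          rw [integral_add (integrable_const 2) (hLp φ hφ), integral_const, smul_eq_mul, mul_comm]
      _ ≤ _ := by linarith [hR φ hφ]
  -- The infima increase as the sets shrink and are bounded, hence converge; this makes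
  -- near-minimizers from late sets nearly optimal in earlier ones.
  let m : ℕ → ℝ := fun n => sInf (G '' K n)
  have hbdd : ∀ n, BddBelow (G '' K n) := fun n => ⟨0, by rintro _ ⟨φ, _, rfl⟩; exact hG0 φ⟩
  have hmle : ∀ n, ∀ φ ∈ K n, m n ≤ G φ := fun n φ hφ => csInf_le (hbdd n) ⟨φ, hφ, rfl⟩
  have hmono : Monotone m := fun i j hij =>
    csInf_le_csInf (hbdd i) ((hne j).image G) (image_mono (hanti hij))
  have hmbdd : BddAbove (range m) := by
    refine ⟨2 * μ.real univ + R, ?_⟩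
    rintro _ ⟨n, rfl⟩
    obtain ⟨φ, hφ⟩ := hne n
    exact (hmle n φ hφ).trans (hGle φ (hK0 n hφ))
  have hsup : ∀ n, m n ≤ ⨆ i, m i := fun n => le_ciSup hmbdd n
  have hex : ∀ n : ℕ, ∃ φ ∈ K n, G φ < m n + 1 / ((n : ℝ) + 1) := fun n => by
    obtain ⟨_, ⟨φ, hφ, rfl⟩, h⟩ := exists_lt_of_csInf_lt ((hne n).image G)
      (lt_add_of_pos_right (m n) (Nat.one_div_pos_of_nat (α := ℝ) (n := n)))
    exact ⟨φ, hφ, h⟩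
  choose ψ hψK hψ using hex
  have hψ0 : ∀ n, ψ n ∈ K 0 := fun n => hK0 n (hψK n)
  -- the convexity gaps of the selection tend to zero
  let Δ : ℕ → ℕ → Ω → ℝ := fun i j t =>
    g (ψ i t) + g (ψ j t) - 2 * g ((1 / 2 : ℝ) • (ψ i t + ψ j t))
  have hmid0 : ∀ i j, (fun t => (1 / 2 : ℝ) • (ψ i t + ψ j t)) ∈ K 0 := fun i j =>
    hmid 0 _ (hψ0 i) _ (hψ0 j)
  have hΔi : ∀ i j, Integrable (Δ i j) μ := fun i j =>
    ((hgi _ (hψ0 i)).add (hgi _ (hψ0 j))).sub ((hgi _ (hmid0 i j)).const_mul 2)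
  -- For `i, j ≥ n` each `G (ψ i)` is at most `⨆ m + 1/(n+1)`, while the midpoint lies in `K n` and
  -- so has `G` at least `m n`.
  let e : ℕ → ℝ := fun n => 2 * ((⨆ i, m i) - m n) + 2 * (1 / ((n : ℝ) + 1))
  have hΔe : ∀ n, ∀ i ≥ n, ∀ j ≥ n, ∫ t, Δ i j t ∂μ ≤ e n := fun n i hi j hj => by
    have h1 : ∫ t, Δ i j t ∂μ = G (ψ i) + G (ψ j) -
        2 * G (fun t => (1 / 2 : ℝ) • (ψ i t + ψ j t)) := by
      have hs : Integrable (fun t => g (ψ i t) + g (ψ j t)) μ :=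
        (hgi _ (hψ0 i)).add (hgi _ (hψ0 j))
      simp only [Δ, G]
      rw [integral_sub hs ((hgi _ (hmid0 i j)).const_mul 2),
        integral_add (hgi _ (hψ0 i)) (hgi _ (hψ0 j)), integral_const_mul]
    have h2 := hmle n _ (hmid n _ (hanti hi (hψK i)) _ (hanti hj (hψK j)))
    have h3 : 1 / ((i : ℝ) + 1) ≤ 1 / ((n : ℝ) + 1) := Nat.one_div_le_one_div hi
    have h4 : 1 / ((j : ℝ) + 1) ≤ 1 / ((n : ℝ) + 1) := Nat.one_div_le_one_div hj
    rw [h1]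
    simp only [e]
    linarith [hψ i, hψ j, hsup i, hsup j]
  have helim : Tendsto e atTop (𝓝 0) := by
    have h1 := (tendsto_const_nhds (x := ⨆ i, m i)).sub (tendsto_atTop_ciSup hmono hmbdd)
    have h2 := (h1.const_mul 2).add ((tendsto_one_div_add_atTop_nhds_zero_nat (𝕜 := ℝ)).const_mul 2)
    simpa [e] using h2
  have hcauchy : ∀ η > 0, ∃ n, ∀ i ≥ n, ∀ j ≥ n, ∫ t, ‖ψ i t - ψ j t‖ ∂μ < η := by
    intro η hη
    set V := μ.real univ with hV
    have hV0 : 0 ≤ V := measureReal_nonneg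
    -- The order of choice is `ε`, then `N`, then `n`, since `N ^ 3 / ε` multiplies the gap; each
    -- term costs at most `η / 3`. The `V + 1` avoids dividing by zero.
    set ε := η / (3 * (V + 1)) with hε
    have hε0 : 0 < ε := by positivity
    set Q : ℝ := 3 ^ p * (2 ^ p * V + R + R) with hQ
    have hNlim : Tendsto (fun N : ℝ => N ^ (1 - p) * Q) atTop (𝓝 0) := by
      have := (tendsto_rpow_neg_atTop (sub_pos.2 hp)).mul_const Q
      simpa using this
    obtain ⟨N, hN1, hN0⟩ := ((hNlim.eventually (gt_mem_nhds (by positivity : 0 < η / 3))).and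
      (eventually_gt_atTop 0)).exists
    have h3 : Tendsto (fun n => N ^ 3 / ε * e n) atTop (𝓝 0) := by
      simpa using helim.const_mul (N ^ 3 / ε)
    obtain ⟨n, hn⟩ := (h3.eventually (gt_mem_nhds (by positivity : 0 < η / 3))).exists
    refine ⟨n, fun i hi j hj => ?_⟩
    have hi1 : Integrable (fun t => 3 ^ p * (2 ^ p + ‖ψ i t‖ ^ p + ‖ψ j t‖ ^ p)) μ :=
      (((integrable_const _).add (hLp _ (hψ0 i))).add (hLp _ (hψ0 j))).const_mul _
    have hi2 : Integrable (fun t => ε + N ^ (1 - p) *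
        (3 ^ p * (2 ^ p + ‖ψ i t‖ ^ p + ‖ψ j t‖ ^ p))) μ :=
      (integrable_const ε).add (hi1.const_mul _)
    have hQi : ∫ t, (3 ^ p * (2 ^ p + ‖ψ i t‖ ^ p + ‖ψ j t‖ ^ p)) ∂μ ≤ Q := by
      have hs : Integrable (fun t => 2 ^ p + ‖ψ i t‖ ^ p) μ :=
        (integrable_const _).add (hLp _ (hψ0 i))
      rw [integral_const_mul, integral_add hs (hLp _ (hψ0 j)), integral_add (integrable_const _) (hLp _ (hψ0 i)), integral_const,
        smul_eq_mul, hQ, mul_comm (μ.real univ)]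
      gcongr
      exacts [hR _ (hψ0 i), hR _ (hψ0 j)]
    have hle : ∫ t, ‖ψ i t - ψ j t‖ ∂μ ≤ ε * V + N ^ (1 - p) * Q + N ^ 3 / ε * e n := by
      calc ∫ t, ‖ψ i t - ψ j t‖ ∂μ ≤ ∫ t, (ε + N ^ (1 - p) *
            (3 ^ p * (2 ^ p + ‖ψ i t‖ ^ p + ‖ψ j t‖ ^ p)) + N ^ 3 / ε * Δ i j t) ∂μ :=
            integral_mono ((hL1 _ (hψ0 i)).sub (hL1 _ (hψ0 j))).norm
              (hi2.add ((hΔi i j).const_mul _))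
              fun t => norm_sub_le_of_sqrt_one_add_sq hp hε0 hN0 _ _
        _ = ε * V + N ^ (1 - p) * (∫ t, (3 ^ p * (2 ^ p + ‖ψ i t‖ ^ p + ‖ψ j t‖ ^ p)) ∂μ) +
              N ^ 3 / ε * ∫ t, Δ i j t ∂μ := by
            rw [integral_add hi2 ((hΔi i j).const_mul _),
              integral_add (integrable_const ε) (hi1.const_mul _), integral_const_mul,
              integral_const_mul _ (Δ i j), integral_const, smul_eq_mul, mul_comm V]
        _ ≤ _ := by
            gcongr
            exact hΔe n i hi j hj
    have hεV : ε * V ≤ η / 3 := by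
      rw [hε, div_mul_eq_mul_div, div_le_div_iff₀ (by positivity) (by norm_num)]
      nlinarith
    linarith
  obtain ⟨F, hF, hlim, ns, hns, hae⟩ :=
    exists_tendsto_integral_norm_sub (fun n => hL1 _ (hψ0 n)) hcauchy
  exact ⟨F, memLp_of_tendsto_ae_of_integral_le hp0 (fun n => hmem _ (hψ0 (ns n)))
    (fun n => hR _ (hψ0 (ns n))) hae, fun n => ψ (ns n),
    fun n => hanti (hns.id_le n) (hψK (ns n)), hlim.comp hns.tendsto_atTop, hae⟩

end Compactness

/-! ### Regularity and growth of the Lagrangian. -/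

section Lagrangian

variable {d : ℕ} {a b : ℝ} {L : Rd d → Rd d → ℝ → ℝ}

/-- The partial gradients in terms of the total derivative of `L` within its domain. -/
theorem hasFDerivAt_of_isC1Lagrangian (hab : a < b) (hL : IsC1Lagrangian a b L) :
    ∃ D : Rd d × Rd d × ℝ → (Rd d × Rd d →L[ℝ] ℝ), ContinuousOn D (univ ×ˢ univ ×ˢ Icc a b) ∧
      ∀ x y, ∀ t ∈ Icc a b, HasFDerivAt (fun z : Rd d × Rd d => L z.1 z.2 t) (D (x, y, t)) (x, y) := by
  set S : Set (Rd d × Rd d × ℝ) := univ ×ˢ univ ×ˢ Icc a b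
  have hS : UniqueDiffOn ℝ S :=
    uniqueDiffOn_univ.prod (uniqueDiffOn_univ.prod (uniqueDiffOn_Icc hab))
  let g : Rd d × Rd d × ℝ → ℝ := fun z => L z.1 z.2.1 z.2.2
  -- `j` is the derivative of the slice `(x, y) ↦ (x, y, t)`, which sends the whole space into `S`.
  -- This turns the derivative within `S` into a full derivative, even at `t = a` and `t = b`.
  let j : Rd d × Rd d →L[ℝ] Rd d × Rd d × ℝ :=
    (ContinuousLinearMap.fst ℝ _ _).prod ((ContinuousLinearMap.snd ℝ _ _).prod 0)
  have hg : ContDiffOn ℝ 1 g S := hL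
  refine ⟨fun z => (fderivWithin ℝ g S z).comp j, ?_, fun x y t ht => ?_⟩
  · exact (hg.continuousOn_fderivWithin hS le_rfl).clm_comp continuousOn_const
  · have hm : (x, y, t) ∈ S := ⟨trivial, trivial, ht⟩
    have h1 : HasFDerivWithinAt g (fderivWithin ℝ g S (x, y, t)) S (x, y, t) :=
      ((hg.differentiableOn one_ne_zero) _ hm).hasFDerivWithinAt
    have h2 : HasFDerivAt (fun z : Rd d × Rd d => (z.1, z.2, t)) j (x, y) :=
      hasFDerivAt_fst.prodMk (hasFDerivAt_snd.prodMk (hasFDerivAt_const t _))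
    have h3 := h1.comp (x, y) (f := fun z : Rd d × Rd d => (z.1, z.2, t)) (s := univ)
      h2.hasFDerivWithinAt (fun z _ => ⟨trivial, trivial, ht⟩)
    exact hasFDerivWithinAt_univ.1 h3

theorem hasFDerivAt_comp_prodMk_left {f : Rd d × Rd d → ℝ} {D : Rd d × Rd d →L[ℝ] ℝ} {x y : Rd d}
    (h : HasFDerivAt f D (x, y)) :
    HasFDerivAt (fun x' => f (x', y)) (D.comp (ContinuousLinearMap.inl ℝ _ _)) x :=
  h.comp x (hasFDerivAt_prodMk_left x y)

theorem hasFDerivAt_comp_prodMk_right {f : Rd d × Rd d → ℝ} {D : Rd d × Rd d →L[ℝ] ℝ} {x y : Rd d}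
    (h : HasFDerivAt f D (x, y)) :
    HasFDerivAt (fun y' => f (x, y')) (D.comp (ContinuousLinearMap.inr ℝ _ _)) y :=
  h.comp y (hasFDerivAt_prodMk_right x y)

theorem continuousOn_partialX (hab : a < b) (hL : IsC1Lagrangian a b L) :
    ContinuousOn (fun z : Rd d × Rd d × ℝ => partialX L z.1 z.2.1 z.2.2)
      (univ ×ˢ univ ×ˢ Icc a b) := by
  obtain ⟨D, hDc, hD⟩ := hasFDerivAt_of_isC1Lagrangian hab hL
  have h : ContinuousOn (fun z : Rd d × Rd d × ℝ => (InnerProductSpace.toDual ℝ (Rd d)).symm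
      ((D z).comp (ContinuousLinearMap.inl ℝ _ _))) (univ ×ˢ univ ×ˢ Icc a b) :=
    (LinearIsometryEquiv.continuous _).comp_continuousOn (hDc.clm_comp continuousOn_const)
  refine h.congr fun z hz => ?_
  rw [partialX, gradient, (hasFDerivAt_comp_prodMk_left (hD z.1 z.2.1 z.2.2 hz.2.2)).fderiv]

theorem continuousOn_partialY (hab : a < b) (hL : IsC1Lagrangian a b L) :
    ContinuousOn (fun z : Rd d × Rd d × ℝ => partialY L z.1 z.2.1 z.2.2)
      (univ ×ˢ univ ×ˢ Icc a b) := by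
  obtain ⟨D, hDc, hD⟩ := hasFDerivAt_of_isC1Lagrangian hab hL
  have h : ContinuousOn (fun z : Rd d × Rd d × ℝ => (InnerProductSpace.toDual ℝ (Rd d)).symm
      ((D z).comp (ContinuousLinearMap.inr ℝ _ _))) (univ ×ˢ univ ×ˢ Icc a b) :=
    (LinearIsometryEquiv.continuous _).comp_continuousOn (hDc.clm_comp continuousOn_const)
  refine h.congr fun z hz => ?_
  rw [partialY, gradient, (hasFDerivAt_comp_prodMk_right (hD z.1 z.2.1 z.2.2 hz.2.2)).fderiv]

theorem hasDerivAt_lagrangian_line (hab : a < b) (hL : IsC1Lagrangian a b L) {t : ℝ}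
    (ht : t ∈ Icc a b) (x h y k : Rd d) (s : ℝ) :
    HasDerivAt (fun s : ℝ => L (x + s • h) (y + s • k) t)
      (inner ℝ (partialX L (x + s • h) (y + s • k) t) h +
        inner ℝ (partialY L (x + s • h) (y + s • k) t) k) s := by
  obtain ⟨D, _, hD⟩ := hasFDerivAt_of_isC1Lagrangian hab hL
  have h1 := hD (x + s • h) (y + s • k) t ht
  have h2 : HasDerivAt (fun s : ℝ => (x + s • h, y + s • k)) (h, k) s := by
    have e : ∀ x h : Rd d, HasDerivAt (fun s : ℝ => x + s • h) h s := fun x h => by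
      simpa using ((hasDerivAt_id s).smul_const h).const_add x
    exact (e x h).prodMk (e y k)
  have h3 := HasFDerivAt.comp_hasDerivAt (f := fun s : ℝ => (x + s • h, y + s • k)) s h1 h2
  refine HasDerivAt.congr_deriv h3 ?_
  unfold partialX partialY gradient
  rw [(hasFDerivAt_comp_prodMk_left h1).fderiv,
    (hasFDerivAt_comp_prodMk_right h1).fderiv, InnerProductSpace.toDual_symm_apply,
    InnerProductSpace.toDual_symm_apply]
  simp [← map_add]

theorem aestronglyMeasurable_comp_of_continuousOn {F : Type*} [TopologicalSpace F]
    (hab : a ≤ b) {G : Rd d × Rd d × ℝ → F}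
    (hG : ContinuousOn G (univ ×ˢ univ ×ˢ Icc a b)) {v φ : ℝ → Rd d}
    (hv : AEStronglyMeasurable v (volIoo a b)) (hφ : AEStronglyMeasurable φ (volIoo a b)) :
    AEStronglyMeasurable (fun t => G (v t, φ t, t)) (volIoo a b) := by
  -- Clamping the time to `[a, b]` extends `G` continuously without changing the composite on `(a,
  -- b)`.
  have hc : Continuous fun z : Rd d × Rd d × ℝ => G (z.1, z.2.1, (projIcc a b hab z.2.2 : ℝ)) := by
    refine hG.comp_continuous (by fun_prop) fun z => ⟨trivial, trivial, Subtype.coe_prop _⟩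
  have hm : AEStronglyMeasurable (fun t => (v t, φ t, t)) (volIoo a b) :=
    hv.prodMk (hφ.prodMk aestronglyMeasurable_id)
  refine (hc.comp_aestronglyMeasurable hm).congr ?_
  refine (ae_restrict_mem measurableSet_Ioo).mono fun t ht => ?_
  simp only
  rw [projIcc_of_mem hab (Ioo_subset_Icc_self ht)]

/-- A growth bound is uniform for `x` in a ball. -/
theorem GrowthBound.exists_forall_le {m : ℝ} {g : Rd d → Rd d → ℝ → ℝ} (hg : GrowthBound a b m g)
    (R : ℝ) : ∃ C, 0 ≤ C ∧ ∀ x, ‖x‖ ≤ R → ∀ y, ∀ t ∈ Icc a b, g x y t ≤ C * (1 + ‖y‖ ^ m) := by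
  obtain ⟨δ, hδ0, hδm, r, s, hr, hs, hr0, hs0, h⟩ := hg
  have hcpt : IsCompact (Metric.closedBall (0 : Rd d) R ×ˢ Icc a b) :=
    (isCompact_closedBall 0 R).prod isCompact_Icc
  have hsub : Metric.closedBall (0 : Rd d) R ×ˢ Icc a b ⊆ univ ×ˢ Icc a b :=
    prod_mono_left (subset_univ _)
  obtain ⟨A, hA⟩ := hcpt.exists_bound_of_continuousOn (hr.mono hsub)
  obtain ⟨B, hB⟩ := hcpt.exists_bound_of_continuousOn (hs.mono hsub)
  refine ⟨|A| + |A| + |B|, by positivity, fun x hx y t ht => ?_⟩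
  have hmem : (x, t) ∈ Metric.closedBall (0 : Rd d) R ×ˢ Icc a b := ⟨by simpa using hx, ht⟩
  have h1 : r x t ≤ |A| := (le_abs_self _).trans ((hA _ hmem).trans (le_abs_self _))
  have h2 : s x t ≤ |B| := (le_abs_self _).trans ((hB _ hmem).trans (le_abs_self _))
  have h3 : ‖y‖ ^ δ ≤ 1 + ‖y‖ ^ m := by
    rcases le_total ‖y‖ 1 with hy | hy
    · have : ‖y‖ ^ δ ≤ 1 := Real.rpow_le_one (norm_nonneg y) hy hδ0
      have : 0 ≤ ‖y‖ ^ m := by positivity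
      linarith
    · have : ‖y‖ ^ δ ≤ ‖y‖ ^ m := Real.rpow_le_rpow_of_exponent_le hy hδm
      linarith
  have h4 : 0 ≤ ‖y‖ ^ m := by positivity
  calc g x y t ≤ r x t * ‖y‖ ^ δ + s x t := h x y t ht
    _ ≤ |A| * (1 + ‖y‖ ^ m) + |B| := by
        gcongr
    _ ≤ _ := by nlinarith [abs_nonneg A, abs_nonneg B, mul_nonneg (abs_nonneg A) h4,
        mul_nonneg (abs_nonneg B) h4]

theorem GrowthBound.mono {m m' : ℝ} {g : Rd d → Rd d → ℝ → ℝ} (hg : GrowthBound a b m g)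
    (h : m ≤ m') : GrowthBound a b m' g := by
  obtain ⟨δ, hδ0, hδm, H⟩ := hg
  exact ⟨δ, hδ0, hδm.trans h, H⟩

theorem exists_forall_abs_lagrangian_le {p : ℝ} (hL : IsC1Lagrangian a b L)
    (h1 : GrowthBound a b p (fun x y t => |L x y t - L x 0 t|)) (R : ℝ) :
    ∃ C, 0 ≤ C ∧ ∀ x, ‖x‖ ≤ R → ∀ y, ∀ t ∈ Icc a b, |L x y t| ≤ C * (1 + ‖y‖ ^ p) := by
  obtain ⟨C, hC0, hC⟩ := h1.exists_forall_le R
  have hc : ContinuousOn (fun z : Rd d × ℝ => L z.1 0 z.2)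
      (Metric.closedBall (0 : Rd d) R ×ˢ Icc a b) :=
    hL.continuousOn.comp (f := fun z : Rd d × ℝ => (z.1, (0 : Rd d), z.2)) (by fun_prop)
      fun z hz => ⟨trivial, trivial, hz.2⟩
  obtain ⟨A, hA⟩ :=
    ((isCompact_closedBall (0 : Rd d) R).prod isCompact_Icc).exists_bound_of_continuousOn hc
  refine ⟨C + |A|, by positivity, fun x hx y t ht => ?_⟩
  have e1 := hC x hx y t ht
  have e2 : |L x 0 t| ≤ |A| := (hA (x, t) ⟨by simpa using hx, ht⟩).trans (le_abs_self A)
  have e3 : |L x y t| ≤ |L x y t - L x 0 t| + |L x 0 t| := by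
    simpa using abs_add_le (L x y t - L x 0 t) (L x 0 t)
  have e4 : 0 ≤ ‖y‖ ^ p := by positivity
  nlinarith [mul_nonneg (abs_nonneg A) e4]

theorem CoerciveLagrangian.exists_forall_le {p : ℝ} (h : CoerciveLagrangian a b p L) :
    ∃ γ δ C : ℝ, 0 < γ ∧ 1 ≤ δ ∧ δ < p ∧ 0 ≤ C ∧
      ∀ x y, ∀ t ∈ Icc a b, γ * ‖y‖ ^ p - C * (1 + ‖x‖ ^ δ) ≤ L x y t := by
  obtain ⟨γ, δ, hγ, hδ1, hδp, c₁, c₂, c₃, _, hc₁, hc₂, hc₃, h⟩ := h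
  obtain ⟨A, hA⟩ := isCompact_Icc.exists_bound_of_continuousOn hc₂
  obtain ⟨B, hB⟩ := isCompact_Icc.exists_bound_of_continuousOn hc₃
  refine ⟨γ, δ, |A| + |B|, hγ, hδ1, hδp, by positivity, fun x y t ht => ?_⟩
  have e1 : -|A| ≤ c₂ t := (abs_le.1 ((hA t ht).trans (le_abs_self A))).1
  have e2 : -|B| ≤ c₃ t := (abs_le.1 ((hB t ht).trans (le_abs_self B))).1
  have e3 : 0 ≤ ‖x‖ ^ δ := by positivity
  have e4 : 0 ≤ ‖y‖ ^ p := by positivity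
  have e5 := mul_le_mul_of_nonneg_right (hc₁ x t ht) e4
  have e6 := mul_le_mul_of_nonneg_right e1 e3
  nlinarith [h x y t ht, mul_nonneg (abs_nonneg B) e3, abs_nonneg A]

end Lagrangian

/-! ### The reduced functional and existence of a minimizer. -/

section Minimization

variable {d : ℕ} {a b α p : ℝ} {L : Rd d → Rd d → ℝ → ℝ}

theorem leftFracInt_add_smul {β t : ℝ} {φ ψ : ℝ → Rd d} (hφ : LeftFracIntExists a β φ t)
    (hψ : LeftFracIntExists a β ψ t) (s : ℝ) :
    leftFracInt a β (fun t => φ t + s • ψ t) t =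
      leftFracInt a β φ t + s • leftFracInt a β ψ t := by
  have h2 : IntervalIntegrable (fun ξ => s • (t - ξ) ^ (β - 1) • ψ ξ) volume a t := hψ.smul s
  simp only [leftFracInt, smul_add, smul_comm _ s]
  rw [intervalIntegral.integral_add hφ h2, intervalIntegral.integral_smul, smul_add, smul_comm s]

theorem leftFracInt_midpoint {β t : ℝ} {φ ψ : ℝ → Rd d} (hφ : LeftFracIntExists a β φ t)
    (hψ : LeftFracIntExists a β ψ t) (s : ℝ) :
    leftFracInt a β (fun t => s • (φ t + ψ t)) t =
      s • (leftFracInt a β φ t + leftFracInt a β ψ t) := by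
  simp only [leftFracInt, smul_add, smul_comm _ s]
  have h1 : IntervalIntegrable (fun ξ => s • (t - ξ) ^ (β - 1) • φ ξ) volume a t := hφ.smul s
  have h2 : IntervalIntegrable (fun ξ => s • (t - ξ) ^ (β - 1) • ψ ξ) volume a t := hψ.smul s
  rw [intervalIntegral.integral_add h1 h2, intervalIntegral.integral_smul,
    intervalIntegral.integral_smul, smul_add, smul_comm s, smul_comm s]

/-- The Lagrangian functional as a function of `φ = D^α_- u`. -/
noncomputable def reducedFunctional (a b α : ℝ) (L : Rd d → Rd d → ℝ → ℝ) (φ : ℝ → Rd d) : ℝ :=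
  ∫ t, L (leftFracInt a α φ t) (φ t) t ∂volIoo a b

theorem integrable_one_add_norm_rpow (hp : 0 < p) {φ : ℝ → Rd d}
    (hφ : MemLp φ (ENNReal.ofReal p) (volIoo a b)) (C : ℝ) :
    Integrable (fun t => C * (1 + ‖φ t‖ ^ p)) (volIoo a b) :=
  ((integrable_const 1).add (integrable_norm_rpow_of_memLp hp hφ)).const_mul C

theorem integrable_lagrangian_of_bounded (hab : a < b) (hp : 0 < p) (hL : IsC1Lagrangian a b L)
    (h1 : GrowthBound a b p (fun x y t => |L x y t - L x 0 t|)) {v φ : ℝ → Rd d} {R : ℝ}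
    (hv : AEStronglyMeasurable v (volIoo a b)) (hvR : ∀ᵐ t ∂volIoo a b, ‖v t‖ ≤ R)
    (hφ : MemLp φ (ENNReal.ofReal p) (volIoo a b)) :
    Integrable (fun t => L (v t) (φ t) t) (volIoo a b) := by
  obtain ⟨C, hC0, hC⟩ := exists_forall_abs_lagrangian_le hL h1 R
  refine (integrable_one_add_norm_rpow hp hφ C).mono'
    (aestronglyMeasurable_comp_of_continuousOn hab.le hL.continuousOn hv hφ.1) ?_
  filter_upwards [hvR, ae_restrict_mem measurableSet_Ioo] with t h2 ht
  exact hC _ h2 _ t (Ioo_subset_Icc_self ht)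

theorem aestronglyMeasurable_leftFracInt (hab : a < b) (hp : 1 < p) (hpα : 1 / p < α)
    {φ : ℝ → Rd d} (hφ : MemLp φ (ENNReal.ofReal p) (volIoo a b)) :
    AEStronglyMeasurable (leftFracInt a α φ) (volIoo a b) :=
  (memLp_leftFracInt hp hpα hab hφ 1).1

theorem exists_forall_norm_leftFracInt_le (hab : a < b) (hp : 1 < p) (hpα : 1 / p < α)
    {φ : ℝ → Rd d} (hφ : MemLp φ (ENNReal.ofReal p) (volIoo a b)) :
    ∃ R, ∀ t ∈ Icc a b, ‖leftFracInt a α φ t‖ ≤ R := by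
  obtain ⟨C, _, hC⟩ := exists_norm_leftFracInt_le d hp hpα hab.le
  exact ⟨_, hC φ hφ⟩

theorem integrable_reduced (hab : a < b) (hp : 1 < p) (hpα : 1 / p < α)
    (hL : IsC1Lagrangian a b L)
    (h1 : GrowthBound a b p (fun x y t => |L x y t - L x 0 t|)) {φ : ℝ → Rd d}
    (hφ : MemLp φ (ENNReal.ofReal p) (volIoo a b)) :
    Integrable (fun t => L (leftFracInt a α φ t) (φ t) t) (volIoo a b) := by
  obtain ⟨R, hR⟩ := exists_forall_norm_leftFracInt_le hab hp hpα hφ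
  exact integrable_lagrangian_of_bounded hab (by linarith) hL h1
    (aestronglyMeasurable_leftFracInt hab hp hpα hφ)
    ((ae_restrict_mem measurableSet_Ioo).mono fun t ht => hR t (Ioo_subset_Icc_self ht)) hφ

theorem reducedFunctional_midpoint_le (hab : a < b) (hp : 1 < p) (hpα : 1 / p < α)
    (hL : IsC1Lagrangian a b L)
    (h1 : GrowthBound a b p (fun x y t => |L x y t - L x 0 t|)) (h5 : ConvexLagrangian a b L)
    {φ ψ : ℝ → Rd d} (hφ : MemLp φ (ENNReal.ofReal p) (volIoo a b))
    (hψ : MemLp ψ (ENNReal.ofReal p) (volIoo a b)) :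
    reducedFunctional a b α L (fun t => (1 / 2 : ℝ) • (φ t + ψ t)) ≤
      1 / 2 * reducedFunctional a b α L φ + 1 / 2 * reducedFunctional a b α L ψ := by
  have hm : MemLp (fun t => (1 / 2 : ℝ) • (φ t + ψ t)) (ENNReal.ofReal p) (volIoo a b) :=
    (hφ.add hψ).const_smul (1 / 2 : ℝ)
  have iφ := (integrable_reduced hab hp hpα hL h1 hφ).const_mul (1 / 2)
  have iψ := (integrable_reduced hab hp hpα hL h1 hψ).const_mul (1 / 2)
  unfold reducedFunctional
  rw [← integral_const_mul, ← integral_const_mul, ← integral_add iφ iψ]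
  refine integral_mono_ae (integrable_reduced hab hp hpα hL h1 hm) (iφ.add iψ) ?_
  refine (ae_restrict_mem measurableSet_Ioo).mono fun t ht => ?_
  have ht' := Ioo_subset_Icc_self ht
  have hc := (h5 t ht').2 (mem_univ (leftFracInt a α φ t, φ t))
    (mem_univ (leftFracInt a α ψ t, ψ t)) (by norm_num : (0 : ℝ) ≤ 1 / 2)
    (by norm_num : (0 : ℝ) ≤ 1 / 2) (by norm_num)
  simp only
  rw [leftFracInt_midpoint (leftFracIntExists_of_memLp hp hpα hab.le hφ ht')
    (leftFracIntExists_of_memLp hp hpα hab.le hψ ht'), smul_add, smul_add]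
  simpa using hc

/-- Integrated coercivity, with the state replaced by its sup bound, leaves only the quantity `X = ∫
‖φ‖^p`: a term linear in `X` against one of order `X^(δ/p)`. -/
theorem integral_lower_bound (hab : a < b) (hp : 1 < p) (hpα : 1 / p < α)
    (hL : IsC1Lagrangian a b L)
    (h1 : GrowthBound a b p (fun x y t => |L x y t - L x 0 t|)) {γ δ C C₀ : ℝ} (hδ : 0 ≤ δ)
    (hC : 0 ≤ C)
    (h4 : ∀ x y, ∀ t ∈ Icc a b, γ * ‖y‖ ^ p - C * (1 + ‖x‖ ^ δ) ≤ L x y t)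
    (hC₀ : ∀ φ : ℝ → Rd d, MemLp φ (ENNReal.ofReal p) (volIoo a b) →
      ∀ t ∈ Icc a b, ‖leftFracInt a α φ t‖ ≤ C₀ * (∫ ξ, ‖φ ξ‖ ^ p ∂volIoo a b) ^ (1 / p))
    {φ : ℝ → Rd d} (hφ : MemLp φ (ENNReal.ofReal p) (volIoo a b)) :
    γ * (∫ t, ‖φ t‖ ^ p ∂volIoo a b) -
      C * (1 + (C₀ * (∫ ξ, ‖φ ξ‖ ^ p ∂volIoo a b) ^ (1 / p)) ^ δ) * (b - a) ≤
      reducedFunctional a b α L φ := by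
  have i1 := (integrable_norm_rpow_of_memLp (by linarith) hφ).const_mul γ
  set N := C₀ * (∫ ξ, ‖φ ξ‖ ^ p ∂volIoo a b) ^ (1 / p)
  have e : ∫ t, (γ * ‖φ t‖ ^ p - C * (1 + N ^ δ)) ∂volIoo a b =
      γ * (∫ t, ‖φ t‖ ^ p ∂volIoo a b) - C * (1 + N ^ δ) * (b - a) := by
    rw [integral_sub i1 (integrable_const _), integral_const_mul, integral_const, smul_eq_mul,
      mul_comm (C * _)]
    simp [volIoo, measureReal_def, hab.le]
  rw [← e]
  refine integral_mono_ae (i1.sub (integrable_const _)) (integrable_reduced hab hp hpα hL h1 hφ) ?_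
  refine (ae_restrict_mem measurableSet_Ioo).mono fun t ht => ?_
  have ht' := Ioo_subset_Icc_self ht
  refine le_trans ?_ (h4 _ _ t ht')
  have := Real.rpow_le_rpow (norm_nonneg _) (hC₀ φ hφ t ht') hδ
  simp only
  gcongr

/-- Sublevel sets of the reduced functional are bounded in `L^p`. -/
theorem exists_integral_norm_rpow_le (hab : a < b) (hp : 1 < p) (hpα : 1 / p < α)
    (hL : IsC1Lagrangian a b L)
    (h1 : GrowthBound a b p (fun x y t => |L x y t - L x 0 t|)) (h4 : CoerciveLagrangian a b p L)
    (M : ℝ) : ∃ R : ℝ, 0 ≤ R ∧ ∀ φ : ℝ → Rd d, MemLp φ (ENNReal.ofReal p) (volIoo a b) →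
      reducedFunctional a b α L φ ≤ M → ∫ t, ‖φ t‖ ^ p ∂volIoo a b ≤ R := by
  obtain ⟨γ, δ, C, hγ, hδ1, hδp, hC, h4⟩ := h4.exists_forall_le
  obtain ⟨C₀, hC₀, hI⟩ := exists_norm_leftFracInt_le d hp hpα hab.le
  -- The lower bound with `X` factored out; it tends to infinity because `δ < p`.
  have hlim : Tendsto (fun X : ℝ => X * (γ - C * C₀ ^ δ * (b - a) * X ^ (-(1 - δ / p))) -
      C * (b - a)) atTop atTop := by
    have h1 : Tendsto (fun X : ℝ => γ - C * C₀ ^ δ * (b - a) * X ^ (-(1 - δ / p))) atTop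
        (𝓝 γ) := by
      have : 0 < 1 - δ / p := by rw [sub_pos, div_lt_one (by linarith)]; exact hδp
      simpa using tendsto_const_nhds.sub
        ((tendsto_rpow_neg_atTop this).const_mul (C * C₀ ^ δ * (b - a)))
    exact tendsto_atTop_add_const_right _ _ (tendsto_id.atTop_mul_pos hγ h1)
  obtain ⟨R, hR⟩ := eventually_atTop.1 (hlim.eventually (eventually_gt_atTop M))
  refine ⟨max R 1, by positivity, fun φ hφ hM => ?_⟩
  by_contra! hX
  set X := ∫ t, ‖φ t‖ ^ p ∂volIoo a b with hXdef
  have hX0 : 0 < X := one_pos.trans ((le_max_right R 1).trans_lt hX)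
  have h6 := hR X ((le_max_left R 1).trans hX.le)
  have h7 := integral_lower_bound hab hp hpα hL h1 (by linarith) hC h4 hI hφ
  rw [← hXdef, Real.mul_rpow hC₀ (by positivity), ← Real.rpow_mul hX0.le,
    show 1 / p * δ = 1 + -(1 - δ / p) by ring, Real.rpow_add hX0, Real.rpow_one] at h7
  nlinarith

theorem exists_forall_le_reducedFunctional (hab : a < b) (hp : 1 < p) (hpα : 1 / p < α)
    (hL : IsC1Lagrangian a b L)
    (h1 : GrowthBound a b p (fun x y t => |L x y t - L x 0 t|))
    (h4 : CoerciveLagrangian a b p L) :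
    ∃ m : ℝ, ∀ φ : ℝ → Rd d, MemLp φ (ENNReal.ofReal p) (volIoo a b) →
      m ≤ reducedFunctional a b α L φ := by
  -- Level `0` suffices: nonnegative values are bounded below trivially, and the remaining `φ` have
  -- `L^p` norm controlled by `R`.
  obtain ⟨R, hR0, hR⟩ := exists_integral_norm_rpow_le hab hp hpα hL h1 h4 0
  obtain ⟨γ, δ, C, hγ, hδ1, hδp, hC, h4⟩ := h4.exists_forall_le
  obtain ⟨C₀, hC₀, hI⟩ := exists_norm_leftFracInt_le d hp hpα hab.le
  have hba := sub_pos.2 hab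
  refine ⟨-(C * (1 + (C₀ * R ^ (1 / p)) ^ δ) * (b - a)), fun φ hφ => ?_⟩
  rcases le_total 0 (reducedFunctional a b α L φ) with h | h
  · exact le_trans (neg_nonpos.2 (by positivity)) h
  · have h7 := integral_lower_bound hab hp hpα hL h1 (by linarith) hC h4 hI hφ
    have h8 := hR φ hφ h
    have h9 : 0 ≤ ∫ t, ‖φ t‖ ^ p ∂volIoo a b :=
      integral_nonneg fun _ => Real.rpow_nonneg (norm_nonneg _) _
    have h10 : C * (1 + (C₀ * (∫ t, ‖φ t‖ ^ p ∂volIoo a b) ^ (1 / p)) ^ δ) * (b - a) ≤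
        C * (1 + (C₀ * R ^ (1 / p)) ^ δ) * (b - a) := by gcongr
    nlinarith [mul_nonneg hγ.le h9]

theorem exists_subseq_tendsto_ae_of_integral_norm {Ω E : Type*} [MeasurableSpace Ω]
    [NormedAddCommGroup E] {μ : Measure Ω} {f : ℕ → Ω → E} {F : Ω → E}
    (hf : ∀ n, Integrable (f n) μ) (hF : Integrable F μ)
    (h : Tendsto (fun n => ∫ t, ‖f n t - F t‖ ∂μ) atTop (𝓝 0)) :
    ∃ ns : ℕ → ℕ, StrictMono ns ∧ ∀ᵐ t ∂μ, Tendsto (fun n => f (ns n) t) atTop (𝓝 (F t)) := by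
  refine (tendstoInMeasure_of_tendsto_eLpNorm one_ne_zero (fun n => (hf n).1) hF.1
    ?_).exists_seq_tendsto_ae
  have := (ENNReal.continuous_ofReal.tendsto 0).comp h
  rw [ENNReal.ofReal_zero] at this
  refine this.congr fun n => ?_
  rw [eLpNorm_one_eq_lintegral_enorm, ← ofReal_integral_norm_eq_lintegral_enorm ((hf n).sub hF)]
  rfl

/-- Fatou's lemma for integrals of real functions with a common lower bound. -/
theorem integral_le_of_tendsto_ae_of_le {Ω : Type*} [MeasurableSpace Ω]
    {μ : Measure Ω} [IsFiniteMeasure μ] {f : ℕ → Ω → ℝ} {F : Ω → ℝ} {B m : ℝ}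
    (hf : ∀ n, Integrable (f n) μ) (hF : Integrable F μ) (hB : ∀ n, ∀ᵐ t ∂μ, -B ≤ f n t)
    (hlim : ∀ᵐ t ∂μ, Tendsto (fun n => f n t) atTop (𝓝 (F t)))
    (hm : Tendsto (fun n => ∫ t, f n t ∂μ) atTop (𝓝 m)) : ∫ t, F t ∂μ ≤ m := by
  have hFB : ∀ᵐ t ∂μ, -B ≤ F t := by
    filter_upwards [hlim, ae_all_iff.2 hB] with t h1 h2
    exact ge_of_tendsto' h1 h2
  have e : ∀ {g : Ω → ℝ}, Integrable g μ → (∀ᵐ t ∂μ, -B ≤ g t) →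
      ENNReal.ofReal (∫ t, (g t + B) ∂μ) = ∫⁻ t, ENNReal.ofReal (g t + B) ∂μ := fun hg h =>
    ofReal_integral_eq_lintegral_ofReal (f := fun t => _ + B) (hg.add (integrable_const B))
      (h.mono fun t ht => by simp only [Pi.zero_apply]; linarith)
  have key : ENNReal.ofReal (∫ t, (F t + B) ∂μ) ≤
      liminf (fun n => ENNReal.ofReal (∫ t, (f n t + B) ∂μ)) atTop := by
    simp only [e hF hFB, e (hf _) (hB _)]
    refine le_trans (le_of_eq (lintegral_congr_ae ?_)) (lintegral_liminf_le' fun n =>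
      ((hf n).add (integrable_const B)).1.aemeasurable.ennreal_ofReal)
    filter_upwards [hlim] with t ht
    exact ((ENNReal.tendsto_ofReal (ht.add_const B)).liminf_eq).symm
  have e2 : ∀ {g : Ω → ℝ}, Integrable g μ → ∫ t, (g t + B) ∂μ = ∫ t, g t ∂μ + μ.real univ * B :=
    fun hg => by rw [integral_add hg (integrable_const B), integral_const, smul_eq_mul]
  have hlim2 : Tendsto (fun n => ENNReal.ofReal (∫ t, (f n t + B) ∂μ)) atTop
      (𝓝 (ENNReal.ofReal (m + μ.real univ * B))) := by
    simp only [e2 (hf _)]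
    exact ENNReal.tendsto_ofReal (hm.add_const _)
  rw [hlim2.liminf_eq, e2 hF] at key
  have hnn : 0 ≤ m + μ.real univ * B := by
    refine ge_of_tendsto' (hm.add_const _) fun n => ?_
    rw [← e2 (hf n)]
    exact integral_nonneg_of_ae ((hB n).mono fun t ht => by simp only [Pi.zero_apply]; linarith)
  have := (ENNReal.ofReal_le_ofReal_iff hnn).1 key
  linarith

/-- The reduced functional attains its minimum on `L^p`. -/
theorem exists_isMinOn_reducedFunctional (hab : a < b) (hp : 1 < p) (hpα : 1 / p < α)
    (hL : IsC1Lagrangian a b L)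
    (h1 : GrowthBound a b p (fun x y t => |L x y t - L x 0 t|))
    (h4 : CoerciveLagrangian a b p L) (h5 : ConvexLagrangian a b L) :
    ∃ φ : ℝ → Rd d, MemLp φ (ENNReal.ofReal p) (volIoo a b) ∧
      ∀ ψ : ℝ → Rd d, MemLp ψ (ENNReal.ofReal p) (volIoo a b) →
        reducedFunctional a b α L φ ≤ reducedFunctional a b α L ψ := by
  have hα0 : 0 < α := lt_trans (by positivity) hpα
  set X : Set (ℝ → Rd d) := {φ | MemLp φ (ENNReal.ofReal p) (volIoo a b)}
  set F := reducedFunctional (d := d) a b α L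
  obtain ⟨m₀, hm₀⟩ := exists_forall_le_reducedFunctional hab hp hpα hL h1 h4
  set m := sInf (F '' X) with hm
  have hbdd : BddBelow (F '' X) := ⟨m₀, by rintro _ ⟨φ, hφ, rfl⟩; exact hm₀ φ hφ⟩
  have hmle : ∀ φ ∈ X, m ≤ F φ := fun φ hφ => csInf_le hbdd ⟨φ, hφ, rfl⟩
  have hXne : (F '' X).Nonempty := ⟨F 0, 0, MemLp.zero, rfl⟩
  let K : ℕ → Set (ℝ → Rd d) := fun n => {φ ∈ X | F φ ≤ m + 1 / ((n : ℝ) + 1)}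
  -- `R` is taken for `K 0`, the largest of the sublevel sets.
  obtain ⟨R, hR0, hR⟩ := exists_integral_norm_rpow_le hab hp hpα hL h1 h4 (m + 1 / ((0 : ℕ) + 1))
  obtain ⟨φ, hφ, f, hfK, hfL1, hfae⟩ := exists_tendsto_of_antitone_midpoint_convex
    (μ := volIoo a b) (R := R) hp (K := K)
    (fun i j hij φ hφ => ⟨hφ.1, hφ.2.trans (by gcongr)⟩)
    (fun n => by
      obtain ⟨_, ⟨φ, hφ, rfl⟩, h⟩ := exists_lt_of_csInf_lt hXne
        (lt_add_of_pos_right m (Nat.one_div_pos_of_nat (α := ℝ) (n := n)))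
      exact ⟨φ, hφ, h.le⟩)
    (fun φ hφ => hφ.1) (fun φ hφ => hR φ hφ.1 (by simpa using hφ.2))
    (fun n φ hφ ψ hψ => ⟨(hφ.1.add hψ.1).const_smul (1 / 2 : ℝ), by
      have := reducedFunctional_midpoint_le hab hp hpα hL h1 h5 hφ.1 hψ.1
      have e1 := hφ.2
      have e2 := hψ.2
      simp only [F] at e1 e2 ⊢
      linarith⟩)
  refine ⟨φ, hφ, fun ψ hψ => le_trans ?_ (hmle ψ hψ)⟩
  have hL1 : ∀ {φ : ℝ → Rd d}, MemLp φ (ENNReal.ofReal p) (volIoo a b) →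
      Integrable φ (volIoo a b) := fun h => h.integrable (by simpa using hp.le)
  have hfX : ∀ n, MemLp (f n) (ENNReal.ofReal p) (volIoo a b) := fun n => (hfK n).1
  obtain ⟨C₁, hC₁⟩ := integral_norm_leftFracInt_le (d := d) hα0 hab.le
  -- The strong `L¹` convergence of the controls passes to the states by the `L¹` bound for `I^α_-`.
  have hu : Tendsto (fun n => ∫ t, ‖leftFracInt a α (f n) t - leftFracInt a α φ t‖ ∂volIoo a b)
      atTop (𝓝 0) := by
    refine squeeze_zero (fun n => integral_nonneg fun _ => norm_nonneg _) (fun n => ?_)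
      (by simpa using hfL1.const_mul C₁)
    refine le_trans (le_of_eq ?_) (hC₁ _ ((hL1 (hfX n)).sub (hL1 hφ))).2
    refine integral_congr_ae ((ae_restrict_mem measurableSet_Ioo).mono fun t ht => ?_)
    have ht' := Ioo_subset_Icc_self ht
    have := leftFracInt_add_smul (leftFracIntExists_of_memLp hp hpα hab.le (hfX n) ht')
      (leftFracIntExists_of_memLp hp hpα hab.le hφ ht') (-1)
    simp only
    congr 1
    rw [sub_eq_add_neg, ← neg_one_smul ℝ, ← this]
    congr 1
    ext1 s
    simp [sub_eq_add_neg]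
  obtain ⟨ns, hns, hae⟩ := exists_subseq_tendsto_ae_of_integral_norm
    (fun n => (hC₁ _ (hL1 (hfX n))).1) (hC₁ _ (hL1 hφ)).1 hu
  obtain ⟨γ, δ, C, hγ, hδ1, hδp, hC, hlow⟩ := h4.exists_forall_le
  obtain ⟨C₀, hC₀, hI⟩ := exists_norm_leftFracInt_le d hp hpα hab.le
  -- `B` is what coercivity leaves after dropping the nonnegative `γ ‖y‖^p` and bounding the states
  -- uniformly over `K 0`.
  refine integral_le_of_tendsto_ae_of_le (B := C * (1 + (C₀ * R ^ (1 / p)) ^ δ))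
    (fun n => integrable_reduced hab hp hpα hL h1 (hfX (ns n)))
    (integrable_reduced hab hp hpα hL h1 hφ) (fun n => ?_) ?_ ?_
  · refine (ae_restrict_mem measurableSet_Ioo).mono fun t ht => ?_
    have ht' := Ioo_subset_Icc_self ht
    have e1 := hlow (leftFracInt a α (f (ns n)) t) (f (ns n) t) t ht'
    have e2 : ∫ t, ‖f (ns n) t‖ ^ p ∂volIoo a b ≤ R :=
      hR _ (hfX _) ((hfK (ns n)).2.trans (by gcongr; exact Nat.zero_le _))
    have e3 : 0 ≤ ∫ t, ‖f (ns n) t‖ ^ p ∂volIoo a b :=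
      integral_nonneg fun _ => Real.rpow_nonneg (norm_nonneg _) _
    have e4 : ‖leftFracInt a α (f (ns n)) t‖ ≤ C₀ * R ^ (1 / p) :=
      (hI _ (hfX _) t ht').trans (by gcongr)
    have e5 : C * (1 + ‖leftFracInt a α (f (ns n)) t‖ ^ δ) ≤
        C * (1 + (C₀ * R ^ (1 / p)) ^ δ) := by gcongr
    have e6 : 0 ≤ γ * ‖f (ns n) t‖ ^ p := by positivity
    linarith
  · filter_upwards [hae, hfae, ae_restrict_mem measurableSet_Ioo] with t h7 h8 ht
    have ht' := Ioo_subset_Icc_self ht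
    have hc := hL.continuousOn (leftFracInt a α φ t, φ t, t) ⟨trivial, trivial, ht'⟩
    have h9 : Tendsto (fun n => (leftFracInt a α (f (ns n)) t, f (ns n) t, t)) atTop
        (𝓝 (leftFracInt a α φ t, φ t, t)) :=
      h7.prodMk_nhds ((h8.comp hns.tendsto_atTop).prodMk_nhds tendsto_const_nhds)
    exact hc.tendsto.comp (tendsto_nhdsWithin_iff.2 ⟨h9, Eventually.of_forall fun n =>
      ⟨trivial, trivial, ht'⟩⟩)
  · refine tendsto_of_tendsto_of_tendsto_of_le_of_le tendsto_const_nhds ?_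
      (fun n => hmle _ (hfX (ns n))) (fun n => (hfK (ns n)).2)
    have := (tendsto_one_div_add_atTop_nhds_zero_nat (𝕜 := ℝ)).comp hns.tendsto_atTop
    simpa using this.const_add m

end Minimization

/-! ### First variation and the Euler–Lagrange equation. -/

section EulerLagrange

variable {d : ℕ} {a b α p : ℝ} {L : Rd d → Rd d → ℝ → ℝ}

theorem integrable_comp_of_growthBound (hab : a < b) (hp : 1 < p) (hpα : 1 / p < α)
    {G : Rd d → Rd d → ℝ → Rd d}
    (hG : ContinuousOn (fun z : Rd d × Rd d × ℝ => G z.1 z.2.1 z.2.2) (univ ×ˢ univ ×ˢ Icc a b))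
    (h : GrowthBound a b p (fun x y t => ‖G x y t‖)) {φ : ℝ → Rd d}
    (hφ : MemLp φ (ENNReal.ofReal p) (volIoo a b)) :
    Integrable (fun t => G (leftFracInt a α φ t) (φ t) t) (volIoo a b) := by
  obtain ⟨R, hR⟩ := exists_forall_norm_leftFracInt_le hab hp hpα hφ
  obtain ⟨C, hC0, hC⟩ := h.exists_forall_le R
  refine (integrable_one_add_norm_rpow (by linarith) hφ C).mono'
    (aestronglyMeasurable_comp_of_continuousOn hab.le hG
      (aestronglyMeasurable_leftFracInt hab hp hpα hφ) hφ.1) ?_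
  refine (ae_restrict_mem measurableSet_Ioo).mono fun t ht => ?_
  exact hC _ (hR t (Ioo_subset_Icc_self ht)) _ t (Ioo_subset_Icc_self ht)

/-- The first variation of the reduced functional in a bounded direction. -/
theorem hasDerivAt_reducedFunctional (hab : a < b) (hp : 1 < p) (hpα : 1 / p < α)
    (hL : IsC1Lagrangian a b L)
    (h1 : GrowthBound a b p (fun x y t => |L x y t - L x 0 t|))
    (h2 : GrowthBound a b p (fun x y t => ‖partialX L x y t‖))
    (h3 : GrowthBound a b p (fun x y t => ‖partialY L x y t‖)) {φ h : ℝ → Rd d}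
    (hφ : MemLp φ (ENNReal.ofReal p) (volIoo a b)) (hh : AEStronglyMeasurable h (volIoo a b))
    {H : ℝ} (hH : ∀ t, ‖h t‖ ≤ H) :
    HasDerivAt (fun s : ℝ => reducedFunctional a b α L (fun t => φ t + s • h t))
      (∫ t, (inner ℝ (partialX L (leftFracInt a α φ t) (φ t) t) (leftFracInt a α h t) +
        inner ℝ (partialY L (leftFracInt a α φ t) (φ t) t) (h t)) ∂volIoo a b) 0 := by
  have hp0 : 0 < p := by linarith
  have hH0 : 0 ≤ H := (norm_nonneg _).trans (hH 0)
  have hhp : MemLp h (ENNReal.ofReal p) (volIoo a b) :=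
    MemLp.of_bound hh H (Eventually.of_forall hH)
  obtain ⟨R, hR⟩ := exists_forall_norm_leftFracInt_le hab hp hpα hφ
  obtain ⟨S, hS⟩ := exists_forall_norm_leftFracInt_le hab hp hpα hhp
  -- For `|s| ≤ 1` the varied state stays in the ball of radius `R + S` and the varied control below
  -- `‖φ‖ + H`, whence the dominating function.
  obtain ⟨C, hC0, hC⟩ := h2.exists_forall_le (R + S)
  obtain ⟨C', hC'0, hC'⟩ := h3.exists_forall_le (R + S)
  have mu := aestronglyMeasurable_leftFracInt hab hp hpα hφ
  have mh := aestronglyMeasurable_leftFracInt hab hp hpα hhp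
  have hlin : ∀ s : ℝ, ∀ t ∈ Ioo a b, leftFracInt a α (fun t => φ t + s • h t) t =
      leftFracInt a α φ t + s • leftFracInt a α h t := fun s t ht =>
    leftFracInt_add_smul (leftFracIntExists_of_memLp hp hpα hab.le hφ (Ioo_subset_Icc_self ht))
      (leftFracIntExists_of_memLp hp hpα hab.le hhp (Ioo_subset_Icc_self ht)) s
  have hred : ∀ s : ℝ, reducedFunctional a b α L (fun t => φ t + s • h t) =
      ∫ t, L (leftFracInt a α φ t + s • leftFracInt a α h t) (φ t + s • h t) t ∂volIoo a b :=
    fun s => setIntegral_congr_fun measurableSet_Ioo fun t ht => by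
      simp only; rw [hlin s t ht]
  simp only [hred]
  have hnorm : MemLp (fun t => ‖φ t‖ + H) (ENNReal.ofReal p) (volIoo a b) :=
    hφ.norm.add (memLp_const H)
  have hbi : Integrable (fun t => C * (1 + (‖φ t‖ + H) ^ p) * S + C' * (1 + (‖φ t‖ + H) ^ p) * H)
      (volIoo a b) := by
    have := (integrable_const 1).add (integrable_norm_rpow_of_memLp hp0 hnorm)
    have e : ∀ t, ‖‖φ t‖ + H‖ = ‖φ t‖ + H := fun t => Real.norm_of_nonneg (by positivity)
    simp only [e] at this
    exact ((this.const_mul C).mul_const S).add ((this.const_mul C').mul_const H)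
  have main := hasDerivAt_integral_of_dominated_loc_of_deriv_le (μ := volIoo a b)
    (F := fun (s : ℝ) t => L (leftFracInt a α φ t + s • leftFracInt a α h t) (φ t + s • h t) t)
    (F' := fun s t => inner ℝ (partialX L (leftFracInt a α φ t + s • leftFracInt a α h t)
        (φ t + s • h t) t) (leftFracInt a α h t) +
      inner ℝ (partialY L (leftFracInt a α φ t + s • leftFracInt a α h t) (φ t + s • h t) t) (h t))
    (x₀ := 0) (s := Metric.ball 0 1)
    (bound := fun t => C * (1 + (‖φ t‖ + H) ^ p) * S + C' * (1 + (‖φ t‖ + H) ^ p) * H)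
    (Metric.ball_mem_nhds 0 one_pos)
    (Eventually.of_forall fun s => aestronglyMeasurable_comp_of_continuousOn hab.le
      hL.continuousOn (mu.add (mh.const_smul s)) (hφ.1.add (hh.const_smul s)))
    (by simpa using integrable_reduced hab hp hpα hL h1 hφ)
    (((aestronglyMeasurable_comp_of_continuousOn hab.le (continuousOn_partialX hab hL)
        (mu.add (mh.const_smul (0 : ℝ))) (hφ.1.add (hh.const_smul (0 : ℝ)))).inner mh).add
      ((aestronglyMeasurable_comp_of_continuousOn hab.le (continuousOn_partialY hab hL)
        (mu.add (mh.const_smul (0 : ℝ))) (hφ.1.add (hh.const_smul (0 : ℝ)))).inner hh))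
    ?_ hbi ?_
  · simpa using main.2
  · refine (ae_restrict_mem measurableSet_Ioo).mono fun t ht s hs => ?_
    have ht' := Ioo_subset_Icc_self ht
    have hs1 : ‖s‖ ≤ 1 := by simpa using (Metric.mem_ball.1 hs).le
    have hx : ‖leftFracInt a α φ t + s • leftFracInt a α h t‖ ≤ R + S := by
      refine (norm_add_le _ _).trans (add_le_add (hR t ht') ?_)
      rw [norm_smul]
      exact (mul_le_of_le_one_left (norm_nonneg _) hs1).trans (hS t ht')
    have hy : ‖φ t + s • h t‖ ≤ ‖φ t‖ + H := by
      refine (norm_add_le _ _).trans (add_le_add le_rfl ?_)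
      rw [norm_smul]
      exact (mul_le_of_le_one_left (norm_nonneg _) hs1).trans (hH t)
    have hyp : ‖φ t + s • h t‖ ^ p ≤ (‖φ t‖ + H) ^ p := Real.rpow_le_rpow (norm_nonneg _) hy hp0.le
    refine (norm_add_le _ _).trans (add_le_add ?_ ?_)
    · refine (norm_inner_le_norm _ _).trans (mul_le_mul ?_ (hS t ht') (norm_nonneg _)
        (by positivity))
      exact (hC _ hx _ t ht').trans (by gcongr)
    · refine (norm_inner_le_norm _ _).trans (mul_le_mul ?_ (hH t) (norm_nonneg _)
        (by positivity))
      exact (hC' _ hx _ t ht').trans (by gcongr)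
  · exact (ae_restrict_mem measurableSet_Ioo).mono fun t ht s _ =>
      hasDerivAt_lagrangian_line hab hL (Ioo_subset_Icc_self ht) _ _ _ _ s

/-- A function orthogonal to all bounded functions vanishes. -/
theorem ae_eq_zero_of_forall_bounded_integral_inner {Ω E : Type*} [MeasurableSpace Ω]
    [NormedAddCommGroup E] [InnerProductSpace ℝ E] {μ : Measure Ω} {g : Ω → E}
    (hg : Integrable g μ)
    (h : ∀ f : Ω → E, AEStronglyMeasurable f μ → (∀ t, ‖f t‖ ≤ 1) →
      ∫ t, inner ℝ (g t) (f t) ∂μ = 0) : g =ᵐ[μ] 0 := by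
  have hc1 : Continuous fun y : E => 1 + ‖y‖ := by fun_prop
  -- The test function `g / (1 + ‖g‖)` is bounded by `1` and pairs with `g` to `‖g‖² / (1 + ‖g‖)`.
  have hc : Continuous fun y : E => (1 + ‖y‖)⁻¹ • y :=
    (hc1.inv₀ fun y => by positivity).smul continuous_id
  have hb : ∀ y : E, ‖(1 + ‖y‖)⁻¹ • y‖ ≤ 1 := fun y => by
    rw [norm_smul, Real.norm_of_nonneg (by positivity), inv_mul_le_iff₀ (by positivity)]
    linarith
  have hm := hc.comp_aestronglyMeasurable hg.1
  have h0 := h _ hm fun t => hb (g t)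
  have hnn : ∀ t, 0 ≤ inner ℝ (g t) ((1 + ‖g t‖)⁻¹ • g t) := fun t => by
    rw [inner_smul_right, real_inner_self_eq_norm_sq]; positivity
  have hi : Integrable (fun t => inner ℝ (g t) ((1 + ‖g t‖)⁻¹ • g t)) μ :=
    hg.norm.mono' (hg.1.inner hm) (Eventually.of_forall fun t =>
      (norm_inner_le_norm _ _).trans (mul_le_of_le_one_right (norm_nonneg _) (hb _)))
  filter_upwards [(integral_eq_zero_iff_of_nonneg hnn hi).1 h0] with t ht
  simp only [Pi.zero_apply, inner_smul_right, real_inner_self_eq_norm_sq, mul_eq_zero,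
    inv_eq_zero] at ht
  rcases ht with ht | ht
  · exact absurd ht (by positivity)
  · simpa using ht

/-- The integrated Euler-Lagrange equation at a minimizer. -/
theorem rightFracInt_add_partialY_eq_zero (hab : a < b) (hp : 1 < p) (hpα : 1 / p < α)
    (hL : IsC1Lagrangian a b L)
    (h1 : GrowthBound a b p (fun x y t => |L x y t - L x 0 t|))
    (h2 : GrowthBound a b p (fun x y t => ‖partialX L x y t‖))
    (h3 : GrowthBound a b p (fun x y t => ‖partialY L x y t‖)) {φ : ℝ → Rd d}
    (hφ : MemLp φ (ENNReal.ofReal p) (volIoo a b))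
    (hmin : ∀ ψ : ℝ → Rd d, MemLp ψ (ENNReal.ofReal p) (volIoo a b) →
        reducedFunctional a b α L φ ≤ reducedFunctional a b α L ψ) :
    (fun t => rightFracInt b α (fun t => partialX L (leftFracInt a α φ t) (φ t) t) t +
      partialY L (leftFracInt a α φ t) (φ t) t) =ᵐ[volIoo a b] 0 := by
  have hα0 : 0 < α := lt_trans (by positivity) hpα
  have hA := integrable_comp_of_growthBound hab hp hpα (continuousOn_partialX hab hL) h2 hφ
  have hB := integrable_comp_of_growthBound hab hp hpα (continuousOn_partialY hab hL) h3 hφ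
  have hIA := integrable_rightFracInt hα0 hab.le hA
  refine ae_eq_zero_of_forall_bounded_integral_inner (hIA.add hB) fun h hh hH => ?_
  have hhp : MemLp h (ENNReal.ofReal p) (volIoo a b) :=
    MemLp.of_bound hh 1 (Eventually.of_forall hH)
  have hloc : IsLocalMin (fun s : ℝ => reducedFunctional a b α L (fun t => φ t + s • h t)) 0 :=
    Eventually.of_forall fun s => by
      simp only [zero_smul, add_zero]
      exact hmin _ (hφ.add (hhp.const_smul s))
  have h0 := hloc.hasDerivAt_eq_zero
    (hasDerivAt_reducedFunctional hab hp hpα hL h1 h2 h3 hφ hh hH)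
  have hib : ∀ {f k : ℝ → Rd d}, Integrable f (volIoo a b) →
      AEStronglyMeasurable k (volIoo a b) → ∀ C, (∀ᵐ t ∂volIoo a b, ‖k t‖ ≤ C) →
      Integrable (fun t => inner ℝ (f t) (k t)) (volIoo a b) := fun hf hk C hC =>
    (hf.norm.mul_const C).mono' (hf.1.inner hk) (hC.mono fun t ht =>
      (norm_inner_le_norm _ _).trans (mul_le_mul_of_nonneg_left ht (norm_nonneg _)))
  obtain ⟨S, hS⟩ := exists_forall_norm_leftFracInt_le hab hp hpα hhp
  have i1 := hib hA (aestronglyMeasurable_leftFracInt hab hp hpα hhp) S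
    ((ae_restrict_mem measurableSet_Ioo).mono fun t ht => hS t (Ioo_subset_Icc_self ht))
  have i2 := hib hB hh 1 (Eventually.of_forall hH)
  have i3 := hib hIA hh 1 (Eventually.of_forall hH)
  rw [integral_add i1 i2, integral_inner_leftFracInt hα0 hab.le hA hh hH, ← integral_add i3 i2]
    at h0
  simpa only [inner_add_left] using h0

/-- Almost everywhere `B = -I^α_+ A`. Fractional integrals ignore null sets, so `I^{1-α}_+ B =
-∫_t^b A` at every `t`. Its derivative is `A` almost everywhere, and `D^α_+` adds a minus sign. -/
theorem rightFracDeriv_of_rightFracInt_add_eq_zero (hab : a < b) (h0 : 0 < α) (hα : α < 1)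
    {A B : ℝ → Rd d} (hA : Integrable A (volIoo a b))
    (h : (fun t => rightFracInt b α A t + B t) =ᵐ[volIoo a b] 0) :
    ∀ᵐ t ∂volIoo a b, RightFracDerivExists b α B t ∧ A t + rightFracDeriv b α B t = 0 := by
  have hBe : B =ᵐ[volIoo a b] rightFracInt b α (fun t => -A t) := by
    refine h.mono fun t ht => ?_
    have e : rightFracInt b α (fun t => -A t) t = -rightFracInt b α A t := by
      simp only [rightFracInt, smul_neg, intervalIntegral.integral_neg]
    rw [e]
    exact eq_neg_of_add_eq_zero_right ht
  have hA' : Integrable (fun t => -A t) (volIoo a b) := hA.neg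
  have hev : ∀ t ∈ Icc a b, RightFracIntExists b (1 - α) B t ∧
      rightFracInt b (1 - α) B t = ∫ ξ in t..b, -A ξ := fun t ht => by
    rw [rightFracIntExists_congr hBe ht, rightFracInt_congr hBe ht]
    exact rightFracInt_rightFracInt h0 hα hA' ht
  have hii : IntervalIntegrable A volume a b :=
    (intervalIntegrable_iff_integrableOn_Ioo_of_le hab.le).2 hA
  filter_upwards [ae_restrict_of_ae (s := Ioo a b) hii.ae_hasDerivAt_integral,
    ae_restrict_mem measurableSet_Ioo] with t ht htm
  have hnear : ∀ᶠ s in 𝓝 t, s ∈ Icc a b :=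
    mem_of_superset (isOpen_Ioo.mem_nhds htm) Ioo_subset_Icc_self
  have htI : t ∈ uIcc a b := by rw [uIcc_of_le hab.le]; exact Ioo_subset_Icc_self htm
  have hd := (ht htI b right_mem_uIcc).congr_of_eventuallyEq
    (f₁ := rightFracInt b (1 - α) B) (hnear.mono fun s hs => by
    rw [(hev s hs).2, intervalIntegral.integral_neg, intervalIntegral.integral_symm b s, neg_neg])
  refine ⟨⟨hnear.mono fun s hs => (hev s hs).1, hd.differentiableAt⟩, ?_⟩
  rw [rightFracDeriv, hd.deriv, add_neg_cancel]

end EulerLagrange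

/-! ### The main theorem. -/

theorem theorem1 (d : ℕ) (hd : 0 < d) (a b : ℝ) (hab : a < b) (α p : ℝ)
    (hp : 0 < 1 / p) (hpα : 1 / p < α) (hα : α < 1)
    (L : Rd d → Rd d → ℝ → ℝ)
    (hL : IsC1Lagrangian a b L)
    (h1 : GrowthBound a b p (fun x y t => |L x y t - L x 0 t|))
    (h2 : GrowthBound a b p (fun x y t => ‖partialX L x y t‖))
    (h3 : GrowthBound a b (p - 1) (fun x y t => ‖partialY L x y t‖))
    (h4 : CoerciveLagrangian a b p L)
    (h5 : ConvexLagrangian a b L) :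
    (∀ v ∈ fracSpace d a b α p,
      IntervalIntegrable (lagrangianIntegrand a α L v) volume a b) ∧
    ∃ u ∈ fracSpace d a b α p,
      IsMinOn (lagrangianFunctional a b α L) (fracSpace d a b α p) u ∧
      IsWeakSolution a b α L u := by
  have hp0 : 0 < p := one_div_pos.1 hp
  have hp1 : 1 < p := by
    have := hpα.trans hα
    rwa [div_lt_one hp0] at this
  have hα0 : 0 < α := hp.trans hpα
  -- For bounded test directions it is enough that `∂_y L` be integrable along `φ`, which exponent
  -- `p` already gives.
  have h3' := h3.mono (sub_le_self p zero_le_one)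
  -- `φ` is any representative of `D^α_- v`: the derivative itself for competitors, the control
  -- found by minimization for the minimizer.
  have hcongr : ∀ v ∈ fracSpace d a b α p, ∀ φ : ℝ → Rd d,
      leftFracDeriv a α v =ᵐ[volIoo a b] φ →
      lagrangianIntegrand a α L v =ᵐ[volIoo a b]
        fun t => L (leftFracInt a α φ t) (φ t) t := fun v hv φ hvφ => by
    filter_upwards [hvφ, hv.2.2.2, ae_restrict_mem measurableSet_Ioo] with t e1 e2 ht
    rw [lagrangianIntegrand, e1, ← leftFracInt_congr hvφ (Ioo_subset_Icc_self ht), e2]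
  have hfun : ∀ v ∈ fracSpace d a b α p, ∀ φ : ℝ → Rd d,
      leftFracDeriv a α v =ᵐ[volIoo a b] φ →
      lagrangianFunctional a b α L v = reducedFunctional a b α L φ := fun v hv φ hvφ => by
    rw [lagrangianFunctional, intervalIntegral.integral_of_le hab.le, integral_Ioc_eq_integral_Ioo]
    exact integral_congr_ae (hcongr v hv φ hvφ)
  refine ⟨fun v hv => ?_, ?_⟩
  · rw [intervalIntegrable_iff_integrableOn_Ioo_of_le hab.le]
    exact (integrable_congr (hcongr v hv _ EventuallyEq.rfl)).2
      (integrable_reduced hab hp1 hpα hL h1 hv.2.2.1)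
  obtain ⟨φ, hφ, hmin⟩ := exists_isMinOn_reducedFunctional hab hp1 hpα hL h1 h4 h5
  have hu := leftFracInt_mem_fracSpace hp1 hpα hα hab hφ
  have hD := leftFracDeriv_leftFracInt hp1 hpα hα hab hφ
  have hDφ : leftFracDeriv a α (leftFracInt a α φ) =ᵐ[volIoo a b] φ := hD.mono fun t ht => ht.2
  refine ⟨leftFracInt a α φ, hu, fun v hv => ?_, continuousOn_leftFracInt hp1 hpα hab hφ, ?_⟩
  · rw [mem_ofPred_eq, hfun _ hu φ hDφ, hfun v hv _ EventuallyEq.rfl]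
    exact hmin _ hv.2.2.1
  · have hA := integrable_comp_of_growthBound hab hp1 hpα (continuousOn_partialX hab hL) h2 hφ
    have hEL := rightFracInt_add_partialY_eq_zero hab hp1 hpα hL h1 h2 h3' hφ hmin
    -- `D^α_+` is nonlocal, so inside `∂_y L` the control `φ` must be replaced by `D^α_- u` as a
    -- function; in `∂_x L` a pointwise replacement at the end is enough.
    have hEL' : (fun t => rightFracInt b α
        (fun t => partialX L (leftFracInt a α φ t) (φ t) t) t +
        partialY L (leftFracInt a α φ t) (leftFracDeriv a α (leftFracInt a α φ) t) t)
        =ᵐ[volIoo a b] 0 := by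
      filter_upwards [hEL, hDφ] with t e1 e2
      rw [e2, e1]
    filter_upwards [hD, rightFracDeriv_of_rightFracInt_add_eq_zero hab hα0 hα hA hEL'] with t e1 e2
    refine ⟨e1.1, e2.1, ?_⟩
    rw [e1.2]
    exact e2.2
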